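/- Let $A$ be a unital $C^*$-algebra and $H$ a complex Hilbert space. Let $\mathcal X=\mathrm{CB}(A,B(H))$ be the space of completely bounded linear maps, with norm $\|\cdot\|_{cb}$, and let $\mathcal C=\mathrm{CP}(A,B(H))\subseteq\mathcal X$ be the cone of completely positive maps. **Bures distance.** For $\phi,\psi\in\mathcal C$ let $$\beta(\phi,\psi)=\inf_{\pi}\ \inf\{\|V-W\| : V,W\in B(H,K),\ \phi(a)=V^*\pi(a)V,\ \psi(a)=W^*\pi(a)W\ \ \forall a\in A\},$$ where $\pi:A\to B(K)$ ranges over all unital $*$-representations of $A$ on Hilbert spaces $K$ and $\inf\emptyset=\infty$. **Regular coordinate.** A multiplicative linear map $\tau:A\to B(K)$ (not necessarily unital or $*$-preserving) is *regular* if $\tau(u)^*\tau(u)=\tau(1)^*\tau(1)$ and $\tau(u)\tau(u)^*=\tau(1)\tau(1)^*$ for all unitaries $u\in A$. A pair $(K,\tau)$, with $K$ a Hilbert space and $\tau:A\to B(K)$ regular, is a *universal regular model* if every linear map $\psi:A\to B(H)$ with $\|\psi\|_{cb}\le1$ can be written $\psi(a)=V^*\tau(a)V$ $(a\in A)$ with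 $V\in B(H,K)$ an isometry. For such a pair and $0\ne\phi\in\mathcal X$ let $$\mathscr R_\tau(\phi)=\bigl\{\|\phi\|_{cb}^{1/2}V: V\in B(H,K)\text{ an isometry},\ \phi(a)/\|\phi\|_{cb}=V^*\tau(a)V\ \ \forall a\in A\bigr\},$$ and $\mathscr R_\tau(0)=\{0\}$. Put $\Gamma_\tau(W)=\frac1{\sqrt2}\binom{W}{\tau(1)W}\in B(H,K\oplus K)$, $\mathscr F_\tau(\phi)=\Gamma_\tau(\mathscr R_\tau(\phi))$, $c_+(\tau)=\sqrt{1+\|\tau(1)\|^2}/\sqrt2$, and $$\delta_{\rm reg}(\phi,\psi)=\sup_{(K,\tau)}\frac{1}{c_+(\tau)}\,d_H\bigl(\mathscr F_\tau(\phi),\mathscr F_\tau(\psi)\bigr),\qquad \rho(\phi)=\delta_{\rm reg}(\phi,0),$$ where $d_H$ is the Hausdorff distance for the operator norm and the supremum is over all universal regular models. Let $\widetilde\delta_{\rm reg}(\phi,\psi)$ be $0$ if $\phi,\psi\in\mathcal C$; $\rho(\phi)$ if $\phi\notin\mathcal C$, $\psi\in\mathcal C$; $\rho(\psi)$ if $\phi\in\mathcal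 C$, $\psi\notin\mathcal C$; and $\delta_{\rm reg}(\phi,\psi)$ if $\phi,\psi\notin\mathcal C$. **Bures--Kuratowski distances.** For $\theta\in\mathcal C$ and $\phi\in\mathcal X$ define $\kappa_\theta(\phi):\mathcal C\to\mathbb R$ by $\kappa_\theta(\phi)(\eta)=\beta(\phi,\eta)-\beta(\theta,\eta)$ if $\phi\in\mathcal C$ and $\kappa_\theta(\phi)=0$ if $\phi\notin\mathcal C$. For $\lambda>0$, $p\in[1,\infty]$, $\alpha\in(0,1]$ let $$\beta^{BK}_{\theta,\lambda,p,\alpha}(\phi,\psi)=\Bigl\|\bigl(\|\kappa_\theta(\phi)-\kappa_\theta(\psi)\|_\infty,\ \lambda\,\widetilde\delta_{\rm reg}(\phi,\psi)^\alpha\bigr)\Bigr\|_{\ell^p(\mathbb R^2)}\qquad(\phi,\psi\in\mathcal X).$$ **Proposition.** Fix $\lambda>0$, $p\in[1,\infty]$ and $\alpha\in(0,1]$. Then $\beta$ is a (finite) metric on $\mathcal C$; for every $\theta\in\mathcal C$ the function $\beta^{BK}_{\theta,\lambda,p,\alpha}$ is a (finite) metric on $\mathcal X$; and the map $\theta\mapsto\beta^{BK}_{\theta,\lambda,p,\alpha}$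 is an isometric embedding of $(\mathcal C,\beta)$ into the set $\mathrm{Met}(\mathcal X)$ of all metrics on $\mathcal X$ with the extended distance $D_\infty(d_1,d_2)=\sup_{\phi,\psi\in\mathcal X}|d_1(\phi,\psi)-d_2(\phi,\psi)|$. That is, the map is injective, and for all $\theta_1,\theta_2\in\mathcal C$ $$D_\infty\bigl(\beta^{BK}_{\theta_1,\lambda,p,\alpha},\beta^{BK}_{\theta_2,\lambda,p,\alpha}\bigr)=\beta(\theta_1,\theta_2).$$ -/

import Mathlib

open scoped ENNReal CStarAlgebra

universe u v

noncomputable section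

namespace BuresKuratowski

/-! Throughout, `A` is a unital C⋆-algebra, equipped with its canonical order (the two classes
`PartialOrder A`, `StarOrderedRing A` determine it uniquely), and `H` is a complex Hilbert space. -/

section CompletelyBounded

variable {A : Type u} {H : Type v} [CStarAlgebra A] [PartialOrder A] [StarOrderedRing A]
  [NormedAddCommGroup H] [InnerProductSpace ℂ H] [CompleteSpace H]

/-- The completely bounded norm, as an extended number: the supremum over `k` and over the unit
ball of `M_k(A)` of the norm of the entrywise application of `φ`. -/
def cbENorm (φ : A →ₗ[ℂ] (H →L[ℂ] H)) : ℝ≥0∞ :=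
  ⨆ (k : ℕ) (M : CStarMatrix (Fin k) (Fin k) A) (_ : ‖M‖ ≤ 1), ‖M.map φ‖ₑ

/-- The completely bounded norm of a completely bounded map, as a real number. -/
def cbNorm (φ : A →ₗ[ℂ] (H →L[ℂ] H)) : ℝ := (cbENorm φ).toReal

variable (A H) in
/-- The space `𝒳 = CB(A, B(H))` of completely bounded linear maps. -/
abbrev CB : Type (max u v) := {φ : A →ₗ[ℂ] (H →L[ℂ] H) // cbENorm φ < ⊤}

variable (A H) in
/-- The cone `𝒞 = CP(A, B(H))` of completely positive maps, as a subset of `CB(A, B(H))`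
(a completely positive map is automatically completely bounded). -/
def CPCone : Set (CB A H) :=
  {φ | ∃ f : A →CP (H →L[ℂ] H), f.toLinearMap = φ.1}

end CompletelyBounded

section Implementers

variable {A : Type u} {H : Type v} [CStarAlgebra A]
  [NormedAddCommGroup H] [InnerProductSpace ℂ H] [CompleteSpace H]
  {K : Type (max u v)} [NormedAddCommGroup K] [InnerProductSpace ℂ K] [CompleteSpace K]

/-- `φ(a) = V⋆ τ(a) V` for all `a`. -/
def Implements (τ : A → (K →L[ℂ] K)) (V : H →L[ℂ] K) (φ : A →ₗ[ℂ] (H →L[ℂ] H)) : Prop :=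
  ∀ a, φ a = (ContinuousLinearMap.adjoint V) ∘L (τ a) ∘L V

/-- The set `𝒮_π(φ)` of all `V` such that `(π, V, K)` is a Stinespring representation of `φ`. -/
def stinespringSet (π : A →⋆ₐ[ℂ] (K →L[ℂ] K)) (φ : A →ₗ[ℂ] (H →L[ℂ] H)) : Set (H →L[ℂ] K) :=
  {V | Implements (fun a => π a) V φ}

/-- `β_π(φ, ψ)`, the infimum of `‖V - W‖` over Stinespring operators of `φ`, `ψ` in the common
representation `π`; it is `∞` if one of the two sets is empty. -/
def buresERep (π : A →⋆ₐ[ℂ] (K →L[ℂ] K)) (φ ψ : A →ₗ[ℂ] (H →L[ℂ] H)) : ℝ≥0∞ :=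
  ⨅ (V ∈ stinespringSet π φ) (W ∈ stinespringSet π ψ), ‖V - W‖ₑ

/-- The Bures distance as an extended number: the infimum of `β_π(φ, ψ)` over all representations
`π` of `A`. Every pair of Stinespring operators already lives in the reducing subspace generated by
their ranges, so Hilbert spaces in the universe of `A` and `H` give the infimum over all of them. -/
def buresEDist (φ ψ : A →ₗ[ℂ] (H →L[ℂ] H)) : ℝ≥0∞ :=
  ⨅ (K : Type (max u v)) (_ : NormedAddCommGroup K) (_ : InnerProductSpace ℂ K)
    (_ : CompleteSpace K) (π : A →⋆ₐ[ℂ] (K →L[ℂ] K)), buresERep π φ ψ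

/-- The Bures distance `β(φ, ψ)` as a real number. -/
def buresDist (φ ψ : A →ₗ[ℂ] (H →L[ℂ] H)) : ℝ := (buresEDist φ ψ).toReal

/-- A (multiplicative, not necessarily unital or `⋆`-preserving) homomorphism `τ : A → B(K)` is
regular if `τ(u)⋆τ(u) = τ(1)⋆τ(1)` and `τ(u)τ(u)⋆ = τ(1)τ(1)⋆` for all unitaries `u`. -/
def IsRegularHom (τ : A →ₙₐ[ℂ] (K →L[ℂ] K)) : Prop :=
  ∀ u ∈ unitary A, star (τ u) * τ u = star (τ 1) * τ 1 ∧ τ u * star (τ u) = τ 1 * star (τ 1)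

end Implementers

section Regular

variable {A : Type u} {H : Type v} [CStarAlgebra A] [PartialOrder A] [StarOrderedRing A]
  [NormedAddCommGroup H] [InnerProductSpace ℂ H] [CompleteSpace H]
  {K : Type (max u v)} [NormedAddCommGroup K] [InnerProductSpace ℂ K] [CompleteSpace K]

variable (H) in
/-- `(K, τ)` is a universal regular model for the completely contractive maps `A → B(H)`: `τ` is
regular, and each completely contractive `ψ` is `V⋆ τ(·) V` for some isometry `V`. -/
def IsUniversalRegularModel (τ : A →ₙₐ[ℂ] (K →L[ℂ] K)) : Prop :=
  IsRegularHom τ ∧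
    ∀ ψ : A →ₗ[ℂ] (H →L[ℂ] H), cbENorm ψ ≤ 1 →
      ∃ V : H →L[ℂ] K, Isometry V ∧ Implements (fun a => τ a) V ψ

open Classical in
/-- The set `ℛ_τ(φ)`: `{0}` if `φ = 0`, and otherwise the operators `‖φ‖_cb^{1/2} V` with `V` an
isometry implementing `φ / ‖φ‖_cb` through `τ`. -/
def regImplementers (τ : A →ₙₐ[ℂ] (K →L[ℂ] K)) (φ : CB A H) : Set (H →L[ℂ] K) :=
  if φ.1 = 0 then {0}
  else {W | ∃ V : H →L[ℂ] K, Isometry V ∧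
    Implements (fun a => τ a) V (((cbNorm φ.1 : ℂ)⁻¹) • φ.1) ∧
    W = ((Real.sqrt (cbNorm φ.1) : ℝ) : ℂ) • V}

/-- `Γ_τ(W) = (1/√2) [W; τ(1) W]`, an operator into the Hilbert space direct sum `K ⊕ K`. -/
def regGamma (τ : A →ₙₐ[ℂ] (K →L[ℂ] K)) (W : H →L[ℂ] K) : H →L[ℂ] WithLp 2 (K × K) :=
  ((1 / Real.sqrt 2 : ℝ) : ℂ) •
    (((WithLp.prodContinuousLinearEquiv 2 ℂ K K).symm : K × K →L[ℂ] WithLp 2 (K × K)) ∘L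
      (W.prod (τ 1 ∘L W)))

/-- The set `ℱ_τ(φ) = Γ_τ(ℛ_τ(φ))`. -/
def regSet (τ : A →ₙₐ[ℂ] (K →L[ℂ] K)) (φ : CB A H) : Set (H →L[ℂ] WithLp 2 (K × K)) :=
  regGamma τ '' regImplementers τ φ

/-- The constant `c₊(τ) = √(1 + ‖τ(1)‖²) / √2`. -/
def cPlus (τ : A →ₙₐ[ℂ] (K →L[ℂ] K)) : ℝ := Real.sqrt (1 + ‖τ 1‖ ^ 2) / Real.sqrt 2

/-- The regular coordinate `δ_reg(φ, ψ)`: the supremum over all universal regular models `(K, τ)` of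
the Hausdorff distance between `ℱ_τ(φ)` and `ℱ_τ(ψ)` divided by `c₊(τ)`. A model can be cut down to
the reducing subspace generated by few implementers, which does not decrease the normalized
distance except by an arbitrarily small amount, so the universe of `A` and `H` suffices. -/
def regEDist (φ ψ : CB A H) : ℝ≥0∞ :=
  ⨆ (K : Type (max u v)) (_ : NormedAddCommGroup K) (_ : InnerProductSpace ℂ K)
    (_ : CompleteSpace K) (τ : A →ₙₐ[ℂ] (K →L[ℂ] K)) (_ : IsUniversalRegularModel H τ),
    Metric.hausdorffEDist (regSet τ φ) (regSet τ ψ) / ENNReal.ofReal (cPlus τ)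

/-- The zero map, as an element of `CB(A, B(H))`. -/
def zeroCB : CB A H := ⟨0, by
  have h : cbENorm (0 : A →ₗ[ℂ] (H →L[ℂ] H)) = 0 := by
    simp only [cbENorm, ENNReal.iSup_eq_zero]
    intro k M _
    have h0 : M.map (0 : A →ₗ[ℂ] (H →L[ℂ] H)) = 0 := by ext; simp
    simp [h0]
  rw [h]; exact ENNReal.zero_lt_top⟩

/-- `ρ(φ) = δ_reg(φ, 0)`. -/
def regRadius (φ : CB A H) : ℝ≥0∞ := regEDist φ zeroCB

open Classical in
/-- The collapsed regular coordinate, in which the cone of completely positive maps is shrunk to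
a point. -/
def collapsedRegEDist (φ ψ : CB A H) : ℝ≥0∞ :=
  if φ ∈ CPCone A H then
    if ψ ∈ CPCone A H then 0 else regRadius ψ
  else
    if ψ ∈ CPCone A H then regRadius φ else regEDist φ ψ

open Classical in
/-- The Kuratowski map `κ_θ`, extended by `0` off the completely positive cone. -/
def kuratowski (θ : CPCone A H) (φ : CB A H) (η : CPCone A H) : ℝ :=
  if φ ∈ CPCone A H then buresDist φ.1 η.1.1 - buresDist θ.1.1 η.1.1 else 0

/-- `‖κ_θ(φ) - κ_θ(ψ)‖_∞`. -/
def kuratowskiEDist (θ : CPCone A H) (φ ψ : CB A H) : ℝ≥0∞ :=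
  ⨆ η : CPCone A H, ‖kuratowski θ φ η - kuratowski θ ψ η‖ₑ

end Regular

/-- The `ℓ^p` norm of a pair of nonnegative extended numbers, for `1 ≤ p ≤ ∞`. -/
def lpPair (p a b : ℝ≥0∞) : ℝ≥0∞ :=
  if p = ⊤ then max a b else (a ^ p.toReal + b ^ p.toReal) ^ (1 / p.toReal)

section Main

variable {A : Type u} {H : Type v} [CStarAlgebra A] [PartialOrder A] [StarOrderedRing A]
  [NormedAddCommGroup H] [InnerProductSpace ℂ H] [CompleteSpace H]

/-- The Bures–Kuratowski distance with anchor `θ` and parameters `lam`, `p`, `alpha`, as an extended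
number. -/
def bkEDist (lam : ℝ) (p : ℝ≥0∞) (alpha : ℝ) (θ : CPCone A H) (φ ψ : CB A H) : ℝ≥0∞ :=
  lpPair p (kuratowskiEDist θ φ ψ) (ENNReal.ofReal lam * collapsedRegEDist φ ψ ^ alpha)

/-- The Bures–Kuratowski distance as a real number. -/
def bkDist (lam : ℝ) (p : ℝ≥0∞) (alpha : ℝ) (θ : CPCone A H) (φ ψ : CB A H) : ℝ :=
  (bkEDist lam p alpha θ φ ψ).toReal

end Main

/-- `d` is a metric on `X`. -/
structure IsMetric {X : Type*} (d : X → X → ℝ) : Prop where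
  nonneg : ∀ x y, 0 ≤ d x y
  eq_zero_iff : ∀ x y, d x y = 0 ↔ x = y
  symm : ∀ x y, d x y = d y x
  triangle : ∀ x y z, d x z ≤ d x y + d y z

/-- `Met(X)`, the collection of all metrics on `X`. -/
abbrev Met (X : Type*) := {d : X → X → ℝ // IsMetric d}

/-- The extended uniform distance `D_∞` between two metrics on `X`. -/
def uniformDist {X : Type*} (d₁ d₂ : Met X) : ℝ≥0∞ :=
  ⨆ (x : X) (y : X), ENNReal.ofReal |d₁.1 x y - d₂.1 x y|

end BuresKuratowski

end

/-!
The Kuratowski coordinate of `β^BK_θ(φ, ψ)` is the Bures distance between the images of `φ` and `ψ`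
under the retraction of `CB(A, B(H))` onto the cone of completely positive maps that sends every
other map to the anchor `θ`, and the second coordinate is the regular coordinate after collapsing
the cone to `0` (`kuratowskiEDist_eq`, `collapsedRegEDist_eq`). The retraction and the collapse
together separate points, so `isMetric_bkDist` follows from Minkowski's inequality once the Bures
distance is a metric on the cone and the regular coordinate is a metric on `CB(A, B(H))`. Moving the
anchor from `θ₁` to `θ₂` affects only pairs with exactly one member in the cone, and by at most
`β(θ₁, θ₂)` (`bkEDist_le_add`); the bound is attained in the limit on pairs `(θ₁, ψ)` with `ψ` off
the cone and tending to `0`, since then the regular coordinate tends to `0`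
(`buresEDist_le_uniformDist`).

The Bures distance is finite because completely positive maps have Stinespring representations
(`exists_stinespring`), which are obtained by a GNS construction for positive definite kernels with
values in the functionals on `A` (`exists_rep_of_posKernel`). For its triangle inequality, two
Stinespring representations of the same map are amalgamated: the partial isometry between the cyclic
subspaces they generate (`exists_partial_intertwiner`) embeds one of them in the direct sum of both.

The regular coordinate separates points because a universal regular model exists
(`exists_universalRegularModel`). The main ingredient is the factorization of a complete contraction
as `φ = V₁⋆ π(·) V₂` with isometries `V₁`, `V₂` (`exists_isometries_of_cbENorm_le_one`). In an
orthonormal basis this asks for a positive definite kernel on `A` over two copies of the basis whose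
off-diagonal corner is `φ` and whose diagonal corners are unital. Such a kernel is a functional on
finitely supported `2 × 2` block matrices over `A`, positive on the cone of positive blocks; it is
prescribed on the blocks with scalar diagonal, where complete contractivity gives positivity
(`re_trace_add_nonneg`), and the M. Riesz extension theorem extends it
(`exists_block_functional`). The direct sum of the representations for all complete contractions,
tensored with a non-selfadjoint idempotent (`skewHom`), is a regular homomorphism through which all
complete contractions are compressed by isometries (`exists_isometry_skewHom`).
-/

noncomputable section

namespace BuresKuratowski

/-! ### Representations from positive definite kernels -/

section Representation

open scoped InnerProductSpace
open UniformSpace Completion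

universe w

variable {A : Type u} [CStarAlgebra A]
variable {E : Type w} [SeminormedAddCommGroup E] [InnerProductSpace ℂ E]

/-- An action of a C⋆-algebra on a semi-inner product space that is compatible with the involution
is bounded, since `‖a‖² - a⋆ a` is a square `c⋆ c`. -/
lemma norm_action_le (L : A →ₐ[ℂ] Module.End ℂ E)
    (hL : ∀ a m n, ⟪L a m, n⟫_ℂ = ⟪m, L (star a) n⟫_ℂ) (a : A) (m : E) :
    ‖L a m‖ ≤ ‖a‖ * ‖m‖ := by
  let _ := CStarAlgebra.spectralOrder A
  have _ := CStarAlgebra.spectralOrderedRing A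
  obtain ⟨c, hc⟩ := CStarAlgebra.nonneg_iff_eq_star_mul_self.mp
    (sub_nonneg.mpr (CStarAlgebra.star_mul_le_algebraMap_norm_sq (a := a)))
  have h : ⟪L a m, L a m⟫_ℂ + ⟪L c m, L c m⟫_ℂ = ((‖a‖ ^ 2 : ℝ) : ℂ) * ⟪m, m⟫_ℂ := by
    rw [hL, hL, ← Module.End.mul_apply, ← Module.End.mul_apply, ← map_mul, ← map_mul,
      ← inner_add_right, ← LinearMap.add_apply, ← map_add, ← hc, add_sub_cancel,
      Algebra.algebraMap_eq_smul_one, ← Complex.coe_smul, map_smul, map_one,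
      LinearMap.smul_apply, Module.End.one_apply, inner_smul_right]
  have h' := congrArg Complex.re h
  rw [Complex.add_re, Complex.re_ofReal_mul] at h'
  have h0 := inner_self_nonneg (𝕜 := ℂ) (x := L c m)
  rw [← sq_le_sq₀ (norm_nonneg _) (by positivity), mul_pow]
  rw [@norm_sq_eq_re_inner ℂ, @norm_sq_eq_re_inner ℂ _ _ _ _ m]
  simp only [RCLike.re_eq_complex_re] at h0 ⊢
  linarith

/-- An action compatible with the involution extends to a representation on the Hilbert space
completion. -/
theorem exists_rep_of_action (L : A →ₐ[ℂ] Module.End ℂ E)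
    (hL : ∀ a m n, ⟪L a m, n⟫_ℂ = ⟪m, L (star a) n⟫_ℂ) :
    ∃ π : A →⋆ₐ[ℂ] (Completion E →L[ℂ] Completion E),
      ∀ a (m : E), π a (m : Completion E) = ((L a m : E) : Completion E) := by
  let B (a : A) : E →L[ℂ] E := (L a).mkContinuous ‖a‖ (norm_action_le L hL a)
  have hB (a : A) (m : E) : (B a).completion (m : Completion E) = ((L a m : E) : Completion E) := by
    rw [ContinuousLinearMap.completion_apply_coe]; rfl
  have ext_coe {S T : Completion E →L[ℂ] Completion E} (h : ∀ m : E, S m = T m) : S = T := by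
    ext c
    induction c using induction_on with
    | hp => apply isClosed_eq <;> fun_prop
    | ih c => exact h c
  refine ⟨{ toFun a := (B a).completion
            map_one' := ?_
            map_mul' := ?_
            map_zero' := ?_
            map_add' := ?_
            commutes' := ?_
            map_star' := ?_ }, hB⟩
  · exact ext_coe fun m => by simp [hB]
  · intro a b
    exact ext_coe fun m => by
      change (B (a * b)).completion m = (B a).completion ((B b).completion m)
      rw [hB, hB, hB, map_mul, Module.End.mul_apply]
  · exact ext_coe fun m => by
      rw [hB, map_zero, LinearMap.zero_apply, coe_zero, _root_.zero_apply]
  · intro a b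
    exact ext_coe fun m => by
      rw [_root_.add_apply, hB, hB, hB, map_add, LinearMap.add_apply, coe_add]
  · intro r
    exact ext_coe fun m => by simp [hB, Algebra.algebraMap_eq_smul_one, coe_smul]
  · intro a
    refine (ContinuousLinearMap.eq_adjoint_iff _ _).mpr fun x y => ?_
    induction x, y using induction_on₂ with
    | hp => apply isClosed_eq <;> fun_prop
    | ih x y => rw [hB, hB, inner_coe, inner_coe, hL, star_star]

end Representation

section Kernel

open scoped InnerProductSpace

universe w

/-- A positive definite kernel on a set `J` with values in the linear functionals on `A`. -/
structure PosKernel (J : Type w) (A : Type u) [CStarAlgebra A] where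
  /-- The functional attached to a pair of points. -/
  toFun : J → J → A →ₗ[ℂ] ℂ
  herm : ∀ i j a, toFun j i (star a) = star (toFun i j a)
  pos : ∀ m : J →₀ A, 0 ≤ (m.sum fun i a => m.sum fun j b => toFun i j (star a * b)).re

namespace PosKernel

variable {J : Type w} {A : Type u} [CStarAlgebra A] (Ψ : PosKernel J A)

/-- The sesquilinear form `(m, n) ↦ ∑ Ψ i j (mᵢ⋆ nⱼ)`. -/
def form (m n : J →₀ A) : ℂ := m.sum fun i a => n.sum fun j b => Ψ.toFun i j (star a * b)

lemma form_add_right (m n n' : J →₀ A) : Ψ.form m (n + n') = Ψ.form m n + Ψ.form m n' := by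
  classical
  unfold form
  rw [← Finsupp.sum_add]
  congr 1; ext i a
  rw [Finsupp.sum_add_index']
  · intro i; simp
  · intro i a b; simp [mul_add]

lemma form_smul_right (c : ℂ) (m n : J →₀ A) : Ψ.form m (c • n) = c * Ψ.form m n := by
  classical
  unfold form
  rw [Finsupp.mul_sum]
  congr 1; ext i a
  rw [Finsupp.sum_smul_index' (by simp), Finsupp.mul_sum]
  simp

lemma star_form (m n : J →₀ A) : star (Ψ.form m n) = Ψ.form n m := by
  unfold form
  simp only [Finsupp.sum, star_sum]
  rw [Finset.sum_comm]
  refine Finset.sum_congr rfl fun j _ => Finset.sum_congr rfl fun i _ => ?_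
  rw [← Ψ.herm]; simp

/-- The semi-inner product on `J →₀ A` given by the form of the kernel. -/
abbrev preInnerCore : PreInnerProductSpace.Core ℂ (J →₀ A) where
  inner m n := Ψ.form m n
  conj_inner_symm m n := Ψ.star_form n m
  re_inner_nonneg m := Ψ.pos m
  add_left m m' n := by
    rw [← Ψ.star_form n, form_add_right, star_add, star_form, star_form]
  smul_left m n c := by
    rw [← Ψ.star_form n (c • m), form_smul_right, star_mul', star_form]; rfl

/-- Left multiplication of `A` on `J →₀ A`. -/
def leftMul : A →ₐ[ℂ] Module.End ℂ (J →₀ A) :=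
  AlgHom.ofLinearMap
    { toFun a := Finsupp.mapRange.linearMap (LinearMap.mulLeft ℂ a)
      map_add' a b := by ext; simp [add_mul]
      map_smul' c a := by
        refine LinearMap.ext fun m => Finsupp.ext fun i => ?_
        simp [Finsupp.mapRange.linearMap_apply] }
    (by ext; simp) (fun a b => by
      refine LinearMap.ext fun m => Finsupp.ext fun i => ?_
      simp [Finsupp.mapRange.linearMap_apply])

lemma leftMul_apply (a : A) (m : J →₀ A) :
    leftMul a m = m.mapRange (fun b => a * b) (mul_zero a) := rfl

lemma form_leftMul (a : A) (m n : J →₀ A) :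
    Ψ.form (leftMul a m) n = Ψ.form m (leftMul (star a) n) := by
  unfold form
  rw [leftMul_apply, Finsupp.sum_mapRange_index (by simp)]
  congr 1; ext i b
  rw [leftMul_apply, Finsupp.sum_mapRange_index (by simp)]
  simp [mul_assoc]

end PosKernel

/-- Every positive definite kernel with values in the functionals on `A` has the form
`Ψ i j a = ⟪v i, π a (v j)⟫` for a representation `π` of `A`. -/
theorem exists_rep_of_posKernel {J : Type w} {A : Type u} [CStarAlgebra A] (Ψ : PosKernel J A) :
    ∃ (K : Type (max u w)) (_ : NormedAddCommGroup K) (_ : InnerProductSpace ℂ K)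
      (_ : CompleteSpace K) (π : A →⋆ₐ[ℂ] (K →L[ℂ] K)) (v : J → K),
      ∀ i j a, ⟪v i, π a (v j)⟫_ℂ = Ψ.toFun i j a := by
  classical
  let _ : SeminormedAddCommGroup (J →₀ A) :=
    InnerProductSpace.Core.toSeminormedAddCommGroup (c := Ψ.preInnerCore)
  let _ : InnerProductSpace ℂ (J →₀ A) := InnerProductSpace.ofCore Ψ.preInnerCore
  have hinner (m n : J →₀ A) : ⟪m, n⟫_ℂ = Ψ.form m n := rfl
  obtain ⟨π, hπ⟩ := exists_rep_of_action (E := J →₀ A) PosKernel.leftMul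
    fun a m n => Ψ.form_leftMul a m n
  refine ⟨UniformSpace.Completion (J →₀ A), inferInstance, inferInstance, inferInstance, π,
    fun j => (Finsupp.single j (1 : A) : J →₀ A), fun i j a => ?_⟩
  rw [hπ, UniformSpace.Completion.inner_coe, hinner]
  simp [PosKernel.form, PosKernel.leftMul_apply]

end Kernel

/-! ### Stinespring dilations of completely positive maps -/

section Stinespring

open scoped InnerProductSpace

variable {A : Type u} {H : Type v} [CStarAlgebra A]
  [NormedAddCommGroup H] [InnerProductSpace ℂ H] [CompleteSpace H]

lemma implements_iff {K : Type (max u v)} [NormedAddCommGroup K] [InnerProductSpace ℂ K]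
    [CompleteSpace K] {τ : A → (K →L[ℂ] K)} {V : H →L[ℂ] K} {φ : A →ₗ[ℂ] (H →L[ℂ] H)} :
    Implements τ V φ ↔ ∀ a x y, ⟪x, φ a y⟫_ℂ = ⟪V x, τ a (V y)⟫_ℂ := by
  refine forall_congr' fun a => ⟨fun h x y => ?_, fun h => ?_⟩
  · rw [h]
    simp [ContinuousLinearMap.adjoint_inner_right]
  · ext y
    refine ext_inner_left ℂ fun x => ?_
    rw [h]
    simp [ContinuousLinearMap.adjoint_inner_right]

lemma exists_eq_star_mul_self_of_nonneg {B : Type*} [NonUnitalCStarAlgebra B] [PartialOrder B]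
    [StarOrderedRing B] {a : B} (ha : 0 ≤ a) : ∃ b, a = star b * b :=
  CStarAlgebra.nonneg_iff_eq_star_mul_self.mp ha

/-- A positive matrix of operators defines a positive semidefinite form on tuples of vectors. -/
lemma re_sum_inner_nonneg {n : Type*} [Fintype n] {N : CStarMatrix n n (H →L[ℂ] H)}
    (hN : 0 ≤ N) (h : n → H) : 0 ≤ (∑ i, ∑ j, ⟪h i, N i j (h j)⟫_ℂ).re := by
  obtain ⟨B, rfl⟩ := exists_eq_star_mul_self_of_nonneg hN
  have key : ∑ i, ∑ j, ⟪h i, (star B * B) i j (h j)⟫_ℂ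
      = ∑ k, ⟪∑ i, B k i (h i), ∑ j, B k j (h j)⟫_ℂ := by
    have entry (i j) : ⟪h i, (star B * B) i j (h j)⟫_ℂ = ∑ k, ⟪B k i (h i), B k j (h j)⟫_ℂ := by
      rw [CStarMatrix.mul_apply, _root_.sum_apply, inner_sum]
      refine Finset.sum_congr rfl fun k _ => ?_
      change ⟪h i, ((ContinuousLinearMap.adjoint (B k i)) ∘L (B k j)) (h j)⟫_ℂ = _
      rw [ContinuousLinearMap.comp_apply, ContinuousLinearMap.adjoint_inner_right]
    simp only [entry, sum_inner, inner_sum]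
    rw [Finset.sum_comm]
    conv_rhs => rw [Finset.sum_comm]
    refine Finset.sum_congr rfl fun i _ => ?_
    rw [Finset.sum_comm]
  rw [key, Complex.re_sum]
  exact Finset.sum_nonneg fun k _ => inner_self_nonneg (𝕜 := ℂ)

/-- A map with bounded Gram kernel is a bounded operator. -/
lemma exists_clm_of_inner_eq {K : Type*} [NormedAddCommGroup K] [InnerProductSpace ℂ K]
    (v : H → K) (T : H →L[ℂ] H) (h : ∀ x y, ⟪v x, v y⟫_ℂ = ⟪x, T y⟫_ℂ) :
    ∃ V : H →L[ℂ] K, ∀ x, V x = v x := by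
  have h' (x y) : ⟪v x, v y⟫_ℂ = ⟪ContinuousLinearMap.adjoint T x, y⟫_ℂ := by
    rw [h, ContinuousLinearMap.adjoint_inner_left]
  let V : H →ₗ[ℂ] K :=
    { toFun := v
      map_add' x y := by
        rw [← sub_eq_zero, ← inner_self_eq_zero (𝕜 := ℂ)]
        simp only [inner_sub_left, inner_add_left, inner_sub_right, inner_add_right, h, map_add]
        ring
      map_smul' c x := by
        rw [← sub_eq_zero, ← inner_self_eq_zero (𝕜 := ℂ)]
        simp only [inner_sub_left, inner_sub_right, h, map_smul, RingHom.id_apply,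
          inner_smul_left, inner_smul_right]
        ring }
  refine ⟨V.mkContinuous (Real.sqrt ‖T‖) fun x => ?_, fun x => rfl⟩
  refine (sq_le_sq₀ (norm_nonneg _) (by positivity)).mp ?_
  rw [mul_pow, Real.sq_sqrt (norm_nonneg _), @norm_sq_eq_re_inner ℂ]
  change RCLike.re ⟪v x, v x⟫_ℂ ≤ _
  rw [h]
  calc RCLike.re ⟪x, T x⟫_ℂ ≤ ‖⟪x, T x⟫_ℂ‖ := RCLike.re_le_norm _
    _ ≤ ‖x‖ * ‖T x‖ := norm_inner_le_norm _ _
    _ ≤ ‖x‖ * (‖T‖ * ‖x‖) := by gcongr; exact T.le_opNorm x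
    _ = ‖T‖ * ‖x‖ ^ 2 := by ring

variable [PartialOrder A] [StarOrderedRing A]

/-- The kernel `(x, y) ↦ ⟪x, φ(·) y⟫` of a completely positive map. -/
def cpKernel (f : A →CP (H →L[ℂ] H)) : PosKernel H A where
  toFun x y := (innerSL ℂ x).toLinearMap ∘ₗ
    (ContinuousLinearMap.apply ℂ H y).toLinearMap ∘ₗ f.toLinearMap
  herm x y a := by
    have h : f (star a) = star (f a) := map_star f a
    change ⟪y, f (star a) x⟫_ℂ = star ⟪x, f a y⟫_ℂ
    rw [h, ContinuousLinearMap.star_eq_adjoint, ContinuousLinearMap.adjoint_inner_right]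
    exact (inner_conj_symm _ _).symm
  pos m := by
    classical
    let M : CStarMatrix m.support m.support A :=
      CStarMatrix.ofMatrix fun i j => star (m i) * m j
    have hM : 0 ≤ M := by
      rcases isEmpty_or_nonempty m.support with he | ⟨⟨k⟩⟩
      · exact (CStarMatrix.ext fun i => (he.false i).elim : M = 0).ge
      · let X : CStarMatrix m.support m.support A :=
          CStarMatrix.ofMatrix fun i j => if i = k then m j else 0
        have : M = star X * X := by
          ext i j
          rw [CStarMatrix.mul_apply, Finset.sum_eq_single k]
          · change _ = star (if k = k then m i else 0) * (if k = k then m j else 0)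
            rw [if_pos rfl, if_pos rfl]; rfl
          · intro l _ hl
            change star (if l = k then m i else 0) * (if l = k then m j else 0) = 0
            simp [hl]
          · simp
        rw [this]
        exact star_mul_self_nonneg X
    have := re_sum_inner_nonneg (f.map_cstarMatrix_nonneg M hM) fun i => (i : H)
    simp only [Finsupp.sum]
    rw [← Finset.sum_coe_sort]
    simp_rw [← Finset.sum_coe_sort m.support]
    exact this

/-- Stinespring's theorem. -/
theorem exists_stinespring (f : A →CP (H →L[ℂ] H)) :
    ∃ (K : Type (max u v)) (_ : NormedAddCommGroup K) (_ : InnerProductSpace ℂ K)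
      (_ : CompleteSpace K) (π : A →⋆ₐ[ℂ] (K →L[ℂ] K)),
      (stinespringSet π f.toLinearMap).Nonempty := by
  obtain ⟨K, i1, i2, i3, π, v, hv⟩ := exists_rep_of_posKernel (cpKernel f)
  have hv' (x y a) : ⟪v x, π a (v y)⟫_ℂ = ⟪x, f a y⟫_ℂ := hv x y a
  obtain ⟨V, hV⟩ := exists_clm_of_inner_eq v (f 1) fun x y => by simpa using hv' x y 1
  refine ⟨K, i1, i2, i3, π, V, implements_iff.mpr fun a x y => ?_⟩
  rw [hV, hV, hv']
  rfl

end Stinespring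

/-! ### Direct sums and amalgamation of representations -/

section DirectSum

open scoped InnerProductSpace

variable {A : Type*} [CStarAlgebra A]
  {E : Type*} [NormedAddCommGroup E] [InnerProductSpace ℂ E]
  {K₁ : Type*} [NormedAddCommGroup K₁] [InnerProductSpace ℂ K₁]
  {K₂ : Type*} [NormedAddCommGroup K₂] [InnerProductSpace ℂ K₂]

/-- The operator `x ↦ (S x, T x)` into the Hilbert space direct sum. -/
def pairL (S : E →L[ℂ] K₁) (T : E →L[ℂ] K₂) : E →L[ℂ] WithLp 2 (K₁ × K₂) :=
  ((WithLp.prodContinuousLinearEquiv 2 ℂ K₁ K₂).symm : K₁ × K₂ →L[ℂ] WithLp 2 (K₁ × K₂)) ∘L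
    S.prod T

@[simp] lemma pairL_fst (S : E →L[ℂ] K₁) (T : E →L[ℂ] K₂) (x : E) : (pairL S T x).fst = S x := rfl

@[simp] lemma pairL_snd (S : E →L[ℂ] K₁) (T : E →L[ℂ] K₂) (x : E) : (pairL S T x).snd = T x := rfl

lemma norm_pairL_apply_sq (S : E →L[ℂ] K₁) (T : E →L[ℂ] K₂) (x : E) :
    ‖pairL S T x‖ ^ 2 = ‖S x‖ ^ 2 + ‖T x‖ ^ 2 :=
  WithLp.prod_norm_sq_eq_of_L2 _

/-- The diagonal operator `(x, y) ↦ (S x, T y)` on the Hilbert space direct sum. -/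
def diagL (S : K₁ →L[ℂ] K₁) (T : K₂ →L[ℂ] K₂) : WithLp 2 (K₁ × K₂) →L[ℂ] WithLp 2 (K₁ × K₂) :=
  ((WithLp.prodContinuousLinearEquiv 2 ℂ K₁ K₂).symm : K₁ × K₂ →L[ℂ] WithLp 2 (K₁ × K₂)) ∘L
    (S.prodMap T) ∘L (WithLp.prodContinuousLinearEquiv 2 ℂ K₁ K₂ :
      WithLp 2 (K₁ × K₂) →L[ℂ] K₁ × K₂)

@[simp] lemma diagL_fst (S : K₁ →L[ℂ] K₁) (T : K₂ →L[ℂ] K₂) (x : WithLp 2 (K₁ × K₂)) :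
    (diagL S T x).fst = S x.fst := rfl

@[simp] lemma diagL_snd (S : K₁ →L[ℂ] K₁) (T : K₂ →L[ℂ] K₂) (x : WithLp 2 (K₁ × K₂)) :
    (diagL S T x).snd = T x.snd := rfl

lemma withLp_prod_ext {K₁ K₂ : Type*} {x y : WithLp 2 (K₁ × K₂)} (h₁ : x.fst = y.fst)
    (h₂ : x.snd = y.snd) : x = y :=
  WithLp.ofLp_injective 2 (Prod.ext h₁ h₂)

variable [CompleteSpace K₁] [CompleteSpace K₂]

/-- The direct sum of two representations. -/
def prodRep (π₁ : A →⋆ₐ[ℂ] (K₁ →L[ℂ] K₁)) (π₂ : A →⋆ₐ[ℂ] (K₂ →L[ℂ] K₂)) :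
    A →⋆ₐ[ℂ] (WithLp 2 (K₁ × K₂) →L[ℂ] WithLp 2 (K₁ × K₂)) where
  toFun a := diagL (π₁ a) (π₂ a)
  map_one' := by ext x; exact withLp_prod_ext (by simp) (by simp)
  map_mul' a b := by ext x; exact withLp_prod_ext (by simp) (by simp)
  map_zero' := by ext x; exact withLp_prod_ext (by simp) (by simp)
  map_add' a b := by ext x; exact withLp_prod_ext (by simp) (by simp)
  commutes' r := by
    ext x
    exact withLp_prod_ext (by simp [Algebra.algebraMap_eq_smul_one])
      (by simp [Algebra.algebraMap_eq_smul_one])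
  map_star' a := by
    refine (ContinuousLinearMap.eq_adjoint_iff _ _).mpr fun x y => ?_
    simp only [WithLp.prod_inner_apply, map_star, ContinuousLinearMap.star_eq_adjoint]
    change ⟪ContinuousLinearMap.adjoint (π₁ a) x.fst, y.fst⟫_ℂ
        + ⟪ContinuousLinearMap.adjoint (π₂ a) x.snd, y.snd⟫_ℂ
      = ⟪x.fst, π₁ a y.fst⟫_ℂ + ⟪x.snd, π₂ a y.snd⟫_ℂ
    rw [ContinuousLinearMap.adjoint_inner_left, ContinuousLinearMap.adjoint_inner_left]

@[simp] lemma prodRep_fst (π₁ : A →⋆ₐ[ℂ] (K₁ →L[ℂ] K₁)) (π₂ : A →⋆ₐ[ℂ] (K₂ →L[ℂ] K₂)) (a : A)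
    (x : WithLp 2 (K₁ × K₂)) : (prodRep π₁ π₂ a x).fst = π₁ a x.fst := rfl

@[simp] lemma prodRep_snd (π₁ : A →⋆ₐ[ℂ] (K₁ →L[ℂ] K₁)) (π₂ : A →⋆ₐ[ℂ] (K₂ →L[ℂ] K₂)) (a : A)
    (x : WithLp 2 (K₁ × K₂)) : (prodRep π₁ π₂ a x).snd = π₂ a x.snd := rfl

end DirectSum

section Amalgam

open scoped InnerProductSpace

variable {A : Type u} {H : Type v} [CStarAlgebra A]
  [NormedAddCommGroup H] [InnerProductSpace ℂ H]
  {K₁ : Type (max u v)} [NormedAddCommGroup K₁] [InnerProductSpace ℂ K₁] [CompleteSpace K₁]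
  {K₂ : Type (max u v)} [NormedAddCommGroup K₂] [InnerProductSpace ℂ K₂] [CompleteSpace K₂]

open scoped TensorProduct in
/-- The linear map `a ⊗ h ↦ π(a) W h`. -/
def cyclicMap {K : Type*} [NormedAddCommGroup K] [InnerProductSpace ℂ K] [CompleteSpace K]
    (π : A →⋆ₐ[ℂ] (K →L[ℂ] K)) (W : H →L[ℂ] K) : A ⊗[ℂ] H →ₗ[ℂ] K :=
  TensorProduct.lift
    (LinearMap.mk₂ ℂ (fun a h => π a (W h)) (by simp) (by simp) (by simp) (by simp))

open scoped TensorProduct in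
lemma cyclicMap_tmul {K : Type*} [NormedAddCommGroup K] [InnerProductSpace ℂ K] [CompleteSpace K]
    (π : A →⋆ₐ[ℂ] (K →L[ℂ] K)) (W : H →L[ℂ] K) (a : A) (h : H) :
    cyclicMap π W (a ⊗ₜ[ℂ] h) = π a (W h) := rfl

lemma rep_inner_left {K : Type*} [NormedAddCommGroup K] [InnerProductSpace ℂ K] [CompleteSpace K]
    (π : A →⋆ₐ[ℂ] (K →L[ℂ] K)) (a : A) (x y : K) : ⟪π a x, y⟫_ℂ = ⟪x, π (star a) y⟫_ℂ := by
  rw [map_star, ContinuousLinearMap.star_eq_adjoint, ContinuousLinearMap.adjoint_inner_right]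

lemma rep_mul_apply {K : Type*} [NormedAddCommGroup K] [InnerProductSpace ℂ K] [CompleteSpace K]
    (π : A →⋆ₐ[ℂ] (K →L[ℂ] K)) (a b : A) (x : K) : π (a * b) x = π a (π b x) := by
  rw [map_mul]; rfl

variable [CompleteSpace H]

open scoped TensorProduct in
/-- The Gram kernel of `a ⊗ h ↦ π(a) W h` depends only on the map implemented by `W`. -/
lemma inner_cyclicMap {π₁ : A →⋆ₐ[ℂ] (K₁ →L[ℂ] K₁)} {π₂ : A →⋆ₐ[ℂ] (K₂ →L[ℂ] K₂)}
    {ψ : A →ₗ[ℂ] (H →L[ℂ] H)} {W₁ : H →L[ℂ] K₁} {W₂ : H →L[ℂ] K₂}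
    (h₁ : W₁ ∈ stinespringSet π₁ ψ) (h₂ : W₂ ∈ stinespringSet π₂ ψ) (s t : A ⊗[ℂ] H) :
    ⟪cyclicMap π₁ W₁ s, cyclicMap π₁ W₁ t⟫_ℂ = ⟪cyclicMap π₂ W₂ s, cyclicMap π₂ W₂ t⟫_ℂ := by
  induction s using TensorProduct.induction_on with
  | zero => simp
  | add s s' hs hs' => simp only [map_add, inner_add_left, hs, hs']
  | tmul a h =>
    induction t using TensorProduct.induction_on with
    | zero => simp
    | add t t' ht ht' => simp only [map_add, inner_add_right, ht, ht']
    | tmul b k =>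
      rw [cyclicMap_tmul, cyclicMap_tmul, cyclicMap_tmul, cyclicMap_tmul, rep_inner_left,
        rep_inner_left, ← rep_mul_apply, ← rep_mul_apply, ← implements_iff.mp h₁,
        ← implements_iff.mp h₂]

open scoped TensorProduct in
/-- Two Stinespring representations of the same map can be amalgamated: there is a partial
intertwiner `T`, isometric on the reducing subspace generated by `W₂ H` with projection `P`, that
carries `W₂` to `W₁`. -/
theorem exists_partial_intertwiner {π₁ : A →⋆ₐ[ℂ] (K₁ →L[ℂ] K₁)} {π₂ : A →⋆ₐ[ℂ] (K₂ →L[ℂ] K₂)}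
    {ψ : A →ₗ[ℂ] (H →L[ℂ] H)} {W₁ : H →L[ℂ] K₁} {W₂ : H →L[ℂ] K₂}
    (h₁ : W₁ ∈ stinespringSet π₁ ψ) (h₂ : W₂ ∈ stinespringSet π₂ ψ) :
    ∃ (T : K₂ →L[ℂ] K₁) (P : K₂ →L[ℂ] K₂),
      (∀ x, ‖T x‖ ^ 2 + ‖x - P x‖ ^ 2 = ‖x‖ ^ 2) ∧ (∀ a x, T (π₂ a x) = π₁ a (T x)) ∧
      (∀ a x, P (π₂ a x) = π₂ a (P x)) ∧ (∀ h, T (W₂ h) = W₁ h) ∧ ∀ h, P (W₂ h) = W₂ h := by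
  let e := cyclicMap π₂ W₂
  let M : Submodule ℂ K₂ := (LinearMap.range e).topologicalClosure
  have : CompleteSpace M := (LinearMap.range e).isClosed_topologicalClosure.completeSpace_coe
  have heM (t) : e t ∈ M := (LinearMap.range e).le_topologicalClosure ⟨t, rfl⟩
  let e' : A ⊗[ℂ] H →ₗ[ℂ] M := e.codRestrict M heM
  have hdense : DenseRange e' := by
    intro x
    rw [closure_subtype, ← Set.range_comp]
    exact x.2
  have hnorm (t) : ‖cyclicMap π₁ W₁ t‖ = ‖e' t‖ := by
    change _ = ‖e t‖
    rw [@norm_eq_sqrt_re_inner ℂ, @norm_eq_sqrt_re_inner ℂ _ _ _ _ (e t), inner_cyclicMap h₁ h₂]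
  let S : M →L[ℂ] K₁ := (cyclicMap π₁ W₁).extendOfNorm e'
  have hS (t) : S (e' t) = cyclicMap π₁ W₁ t :=
    LinearMap.extendOfNorm_eq hdense ⟨1, fun t => by rw [hnorm, one_mul]⟩ t
  have hSnorm (x : M) : ‖S x‖ = ‖x‖ :=
    hdense.induction_on x (isClosed_eq (by fun_prop) (by fun_prop)) fun t => by rw [hS, hnorm]
  have hact (a : A) (t : A ⊗[ℂ] H) :
      ∃ t', e t' = π₂ a (e t) ∧ cyclicMap π₁ W₁ t' = π₁ a (cyclicMap π₁ W₁ t) := by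
    induction t using TensorProduct.induction_on with
    | zero => exact ⟨0, by simp⟩
    | tmul b h =>
      exact ⟨(a * b) ⊗ₜ h, rep_mul_apply π₂ a b _, rep_mul_apply π₁ a b _⟩
    | add s t hs ht =>
      obtain ⟨s', h1, h2⟩ := hs
      obtain ⟨t', h3, h4⟩ := ht
      exact ⟨s' + t', by simp [h1, h3], by simp [h2, h4]⟩
  have hMinv (a : A) (x : K₂) (hx : x ∈ M) : π₂ a x ∈ M := by
    refine map_mem_closure (π₂ a).continuous hx ?_
    rintro _ ⟨t, rfl⟩
    obtain ⟨t', h, -⟩ := hact a t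
    exact ⟨t', h⟩
  have hMperp (a : A) (x : K₂) (hx : x ∈ Mᗮ) : π₂ a x ∈ Mᗮ := by
    intro m hm
    have := hx _ (hMinv (star a) m hm)
    rwa [rep_inner_left, star_star] at this
  have hPcomm (a : A) (x : K₂) : M.starProjection (π₂ a x) = π₂ a (M.starProjection x) := by
    refine (Submodule.eq_starProjection_of_mem_orthogonal (hMinv a _ (M.starProjection_apply_mem x))
      ?_)
    rw [← map_sub]
    exact hMperp a _ (M.sub_starProjection_mem_orthogonal x)
  have hSint (a : A) (m : M) : S ⟨π₂ a m, hMinv a m m.2⟩ = π₁ a (S m) := by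
    refine hdense.induction_on m (isClosed_eq ?_ (by fun_prop)) fun t => ?_
    · exact S.continuous.comp (by fun_prop)
    · obtain ⟨t', h3, h4⟩ := hact a t
      rw [hS, ← h4, ← hS]
      congr 1
      exact Subtype.ext h3.symm
  have hfix (x : K₂) (hx : x ∈ M) : M.starProjection x = x :=
    Submodule.starProjection_eq_self_iff.mpr hx
  have hWM (h : H) : W₂ h ∈ M := by
    have := heM (1 ⊗ₜ h)
    rwa [show e (1 ⊗ₜ h) = W₂ h by simp [e, cyclicMap_tmul]] at this
  refine ⟨S ∘L M.orthogonalProjectionOnto, M.starProjection, fun x => ?_, fun a x => ?_, hPcomm,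
    fun h => ?_, fun h => hfix _ (hWM h)⟩
  · rw [ContinuousLinearMap.comp_apply, hSnorm]
    have := norm_add_sq_eq_norm_sq_add_norm_sq_of_inner_eq_zero (𝕜 := ℂ) (M.starProjection x)
      (x - M.starProjection x) (M.sub_starProjection_mem_orthogonal x _
        (M.starProjection_apply_mem x))
    rw [add_sub_cancel] at this
    rw [sq, sq, sq, this]
    rfl
  · rw [ContinuousLinearMap.comp_apply, ContinuousLinearMap.comp_apply, ← hSint]
    congr 1
    exact Subtype.ext (hPcomm a x)
  · have : M.orthogonalProjectionOnto (W₂ h) = e' (1 ⊗ₜ h) := by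
      refine Subtype.ext ((hfix _ (hWM h)).trans ?_)
      simp [e', e, cyclicMap_tmul]
    rw [ContinuousLinearMap.comp_apply, this, hS]
    simp [cyclicMap_tmul]

end Amalgam

/-! ### The Bures distance -/

section Bures

variable {A : Type u} {H : Type v} [CStarAlgebra A]
  [NormedAddCommGroup H] [InnerProductSpace ℂ H] [CompleteSpace H]

lemma buresEDist_le {K : Type (max u v)} [i1 : NormedAddCommGroup K] [i2 : InnerProductSpace ℂ K]
    [i3 : CompleteSpace K] (π : A →⋆ₐ[ℂ] (K →L[ℂ] K)) {φ ψ : A →ₗ[ℂ] (H →L[ℂ] H)}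
    {V W : H →L[ℂ] K} (hV : V ∈ stinespringSet π φ) (hW : W ∈ stinespringSet π ψ) :
    buresEDist φ ψ ≤ ‖V - W‖ₑ :=
  iInf_le_of_le K <| iInf_le_of_le i1 <| iInf_le_of_le i2 <| iInf_le_of_le i3 <|
    iInf_le_of_le π <| iInf₂_le_of_le V hV <| iInf₂_le W hW

lemma le_buresEDist {c : ℝ≥0∞} {φ ψ : A →ₗ[ℂ] (H →L[ℂ] H)}
    (h : ∀ (K : Type (max u v)) (_ : NormedAddCommGroup K) (_ : InnerProductSpace ℂ K)
      (_ : CompleteSpace K) (π : A →⋆ₐ[ℂ] (K →L[ℂ] K)) (V W : H →L[ℂ] K),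
      V ∈ stinespringSet π φ → W ∈ stinespringSet π ψ → c ≤ ‖V - W‖ₑ) :
    c ≤ buresEDist φ ψ :=
  le_iInf fun K => le_iInf fun i1 => le_iInf fun i2 => le_iInf fun i3 => le_iInf fun π =>
    le_iInf₂ fun V hV => le_iInf₂ fun W hW => h K i1 i2 i3 π V W hV hW

lemma buresEDist_comm (φ ψ : A →ₗ[ℂ] (H →L[ℂ] H)) : buresEDist φ ψ = buresEDist ψ φ := by
  have key (φ ψ : A →ₗ[ℂ] (H →L[ℂ] H)) : buresEDist φ ψ ≤ buresEDist ψ φ := by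
    refine le_buresEDist fun K _ _ _ π V W hV hW => ?_
    rw [← enorm_neg, neg_sub]
    exact buresEDist_le π hW hV
  exact le_antisymm (key _ _) (key _ _)

open scoped InnerProductSpace in
/-- The triangle inequality for the Bures distance: two representations implementing `ψ` embed into
a common one in such a way that the two Stinespring operators of `ψ` become equal. -/
lemma buresEDist_triangle (φ ψ χ : A →ₗ[ℂ] (H →L[ℂ] H)) :
    buresEDist φ χ ≤ buresEDist φ ψ + buresEDist ψ χ := by
  have key {K₁ K₂ : Type (max u v)} [NormedAddCommGroup K₁] [InnerProductSpace ℂ K₁]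
      [CompleteSpace K₁] [NormedAddCommGroup K₂] [InnerProductSpace ℂ K₂] [CompleteSpace K₂]
      (π₁ : A →⋆ₐ[ℂ] (K₁ →L[ℂ] K₁)) (π₂ : A →⋆ₐ[ℂ] (K₂ →L[ℂ] K₂)) (V W₁ : H →L[ℂ] K₁)
      (W₂ X : H →L[ℂ] K₂) (hV : V ∈ stinespringSet π₁ φ) (hW₁ : W₁ ∈ stinespringSet π₁ ψ)
      (hW₂ : W₂ ∈ stinespringSet π₂ ψ) (hX : X ∈ stinespringSet π₂ χ) :
      buresEDist φ χ ≤ ‖V - W₁‖ₑ + ‖W₂ - X‖ₑ := by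
    obtain ⟨T, P, hnorm, hT, hP, hTW, hPW⟩ := exists_partial_intertwiner hW₁ hW₂
    let j : K₂ →ₗᵢ[ℂ] WithLp 2 (K₁ × K₂) :=
      { (pairL T (ContinuousLinearMap.id ℂ K₂ - P) : K₂ →ₗ[ℂ] WithLp 2 (K₁ × K₂)) with
        norm_map' := fun x => by
          refine (sq_eq_sq₀ (norm_nonneg _) (norm_nonneg _)).mp ?_
          exact (norm_pairL_apply_sq _ _ x).trans (hnorm x) }
    have hj (x : K₂) : j x = pairL T (ContinuousLinearMap.id ℂ K₂ - P) x := rfl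
    have hjπ (a : A) (x : K₂) : prodRep π₁ π₂ a (j x) = j (π₂ a x) :=
      withLp_prod_ext (by simp [hj, hT]) (by simp [hj, hP])
    let V' : H →L[ℂ] WithLp 2 (K₁ × K₂) := pairL V 0
    let X' : H →L[ℂ] WithLp 2 (K₁ × K₂) := j.toContinuousLinearMap ∘L X
    have hV' : V' ∈ stinespringSet (prodRep π₁ π₂) φ :=
      implements_iff.mpr fun a x y => by
        rw [WithLp.prod_inner_apply, implements_iff.mp hV]
        change _ = ⟪V x, π₁ a (V y)⟫_ℂ + ⟪(0 : K₂), π₂ a 0⟫_ℂ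
        simp
    have hX' : X' ∈ stinespringSet (prodRep π₁ π₂) χ :=
      implements_iff.mpr fun a x y => by
        change _ = ⟪j (X x), prodRep π₁ π₂ a (j (X y))⟫_ℂ
        rw [hjπ, j.inner_map_map, implements_iff.mp hX]
    refine (buresEDist_le _ hV' hX').trans ?_
    have hsplit : V' - X' = pairL (V - W₁) 0 + j.toContinuousLinearMap ∘L (W₂ - X) := by
      ext h
      refine withLp_prod_ext ?_ ?_
      · change V h - T (X h) = (V h - W₁ h) + T (W₂ h - X h)
        rw [map_sub, hTW]; abel
      · change 0 - (X h - P (X h)) = 0 + ((W₂ h - X h) - P (W₂ h - X h))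
        rw [map_sub, hPW]; abel
    rw [hsplit]
    rw [← ofReal_norm, ← ofReal_norm, ← ofReal_norm,
      ← ENNReal.ofReal_add (norm_nonneg _) (norm_nonneg _)]
    refine ENNReal.ofReal_le_ofReal ((norm_add_le _ _).trans (add_le_add ?_ ?_))
    · refine ContinuousLinearMap.opNorm_le_bound _ (norm_nonneg _) fun h => ?_
      refine le_trans (le_of_eq ?_) ((V - W₁).le_opNorm h)
      refine (sq_eq_sq₀ (norm_nonneg _) (norm_nonneg _)).mp ?_
      rw [norm_pairL_apply_sq]; simp
    · refine ContinuousLinearMap.opNorm_le_bound _ (norm_nonneg _) fun h => ?_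
      exact (j.norm_map _).trans_le ((W₂ - X).le_opNorm h)
  conv_rhs => simp only [buresEDist, buresERep, ENNReal.iInf_add, ENNReal.add_iInf]
  exact le_iInf fun K₂ => le_iInf fun _ => le_iInf fun _ => le_iInf fun _ => le_iInf fun π₂ =>
    le_iInf fun W₂ => le_iInf fun hW₂ => le_iInf fun X => le_iInf fun hX =>
    le_iInf fun K₁ => le_iInf fun _ => le_iInf fun _ => le_iInf fun _ => le_iInf fun π₁ =>
    le_iInf fun V => le_iInf fun hV => le_iInf fun W₁ => le_iInf fun hW₁ =>
    key π₁ π₂ V W₁ W₂ X hV hW₁ hW₂ hX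

lemma norm_of_mem_stinespringSet {K : Type (max u v)} [NormedAddCommGroup K]
    [InnerProductSpace ℂ K] [CompleteSpace K] {π : A →⋆ₐ[ℂ] (K →L[ℂ] K)}
    {φ : A →ₗ[ℂ] (H →L[ℂ] H)} {V : H →L[ℂ] K} (hV : V ∈ stinespringSet π φ) :
    ‖V‖ = √‖φ 1‖ := by
  rw [hV 1]
  simp only [map_one]
  refine ((Real.sqrt_eq_iff_mul_self_eq (norm_nonneg _) (norm_nonneg _)).mpr ?_).symm
  exact V.norm_adjoint_comp_self

/-- Operators that are close implement maps that are close, pointwise. -/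
lemma norm_sub_le_of_implements {K : Type (max u v)} [NormedAddCommGroup K]
    [InnerProductSpace ℂ K] [CompleteSpace K] {τ : A → (K →L[ℂ] K)}
    {φ ψ : A →ₗ[ℂ] (H →L[ℂ] H)} {V W : H →L[ℂ] K} (hV : Implements τ V φ)
    (hW : Implements τ W ψ) (a : A) :
    ‖φ a - ψ a‖ ≤ (‖V‖ + ‖W‖) * ‖τ a‖ * ‖V - W‖ := by
  have hsplit : φ a - ψ a = ContinuousLinearMap.adjoint (V - W) ∘L τ a ∘L V
      + ContinuousLinearMap.adjoint W ∘L τ a ∘L (V - W) := by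
    rw [hV a, hW a]
    ext x
    simp
  have h (X Y : H →L[ℂ] K) :
      ‖ContinuousLinearMap.adjoint X ∘L τ a ∘L Y‖ ≤ ‖X‖ * (‖τ a‖ * ‖Y‖) := by
    refine (ContinuousLinearMap.opNorm_comp_le _ _).trans ?_
    rw [LinearIsometryEquiv.norm_map]
    gcongr
    exact ContinuousLinearMap.opNorm_comp_le _ _
  rw [hsplit]
  refine (norm_add_le _ _).trans ((add_le_add (h _ _) (h _ _)).trans_eq ?_)
  ring

lemma eq_of_buresEDist_eq_zero {φ ψ : A →ₗ[ℂ] (H →L[ℂ] H)} (h : buresEDist φ ψ = 0) : φ = ψ := by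
  ext1 a
  rw [← sub_eq_zero, ← enorm_eq_zero, ← nonpos_iff_eq_zero]
  set C : ℝ := (√‖φ 1‖ + √‖ψ 1‖) * ‖a‖
  have hC : 0 ≤ C := by positivity
  have key : ‖φ a - ψ a‖ₑ / ENNReal.ofReal (C + 1) ≤ buresEDist φ ψ := by
    refine le_buresEDist fun K _ _ _ π V W hV hW => ENNReal.div_le_of_le_mul ?_
    rw [← ofReal_norm, ← ofReal_norm, ← ENNReal.ofReal_mul (norm_nonneg _)]
    have hπ : ‖π a‖ ≤ ‖a‖ := NonUnitalStarAlgHom.norm_apply_le π a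
    refine ENNReal.ofReal_le_ofReal ((norm_sub_le_of_implements hV hW a).trans ?_)
    rw [mul_comm (‖V - W‖), norm_of_mem_stinespringSet hV, norm_of_mem_stinespringSet hW]
    gcongr
    exact (mul_le_mul_of_nonneg_left hπ (by positivity)).trans (by simp [C])
  rw [h, nonpos_iff_eq_zero, ENNReal.div_eq_zero_iff] at key
  exact (key.resolve_right ENNReal.ofReal_ne_top).le

variable [PartialOrder A] [StarOrderedRing A]

lemma buresEDist_self (f : A →CP (H →L[ℂ] H)) : buresEDist f.toLinearMap f.toLinearMap = 0 := by
  obtain ⟨K, _, _, _, π, V, hV⟩ := exists_stinespring f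
  exact nonpos_iff_eq_zero.mp ((buresEDist_le π hV hV).trans_eq (by simp [← ofReal_norm]))

lemma buresEDist_ne_top (f g : A →CP (H →L[ℂ] H)) :
    buresEDist f.toLinearMap g.toLinearMap ≠ ⊤ := by
  obtain ⟨K₁, _, _, _, π₁, V, hV⟩ := exists_stinespring f
  obtain ⟨K₂, _, _, _, π₂, W, hW⟩ := exists_stinespring g
  refine ne_top_of_le_ne_top enorm_ne_top (buresEDist_le (prodRep π₁ π₂) (V := pairL V 0)
    (W := pairL 0 W) (implements_iff.mpr fun a x y => ?_) (implements_iff.mpr fun a x y => ?_))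
  · rw [WithLp.prod_inner_apply, implements_iff.mp hV]
    change _ = inner ℂ (V x) (π₁ a (V y)) + inner ℂ (0 : K₂) (π₂ a 0)
    simp
  · rw [WithLp.prod_inner_apply, implements_iff.mp hW]
    change _ = inner ℂ (0 : K₁) (π₁ a 0) + inner ℂ (W x) (π₂ a (W y))
    simp

end Bures

/-! ### Matrix inequalities for completely contractive maps -/

section ScalarMatrix

open scoped Matrix

variable {A : Type u} [CStarAlgebra A]

/-- A scalar matrix, viewed as a matrix over the algebra `A`. -/
def scalarMat (A : Type u) [CStarAlgebra A] {n : Type*} (α : Matrix n n ℂ) : Matrix n n A :=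
  α.map (algebraMap ℂ A)

lemma scalarMat_mul {n : Type*} [Fintype n] (α β : Matrix n n ℂ) :
    scalarMat A (α * β) = scalarMat A α * scalarMat A β :=
  Matrix.map_mul

lemma scalarMat_conjTranspose {n : Type*} (α : Matrix n n ℂ) :
    scalarMat A αᴴ = (scalarMat A α)ᴴ := by
  ext i j
  simp [scalarMat, Algebra.algebraMap_eq_smul_one]

lemma scalarMat_add {n : Type*} (α β : Matrix n n ℂ) :
    scalarMat A (α + β) = scalarMat A α + scalarMat A β := by
  ext i j
  simp [scalarMat]

lemma scalarMat_one {n : Type*} [DecidableEq n] : scalarMat A (1 : Matrix n n ℂ) = 1 := by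
  ext i j
  rw [scalarMat, Matrix.map_apply, Matrix.one_apply, Matrix.one_apply]
  split_ifs <;> simp

end ScalarMatrix

section MatrixInequality

open scoped InnerProductSpace Matrix

variable {A : Type u} {H : Type v} [CStarAlgebra A] [PartialOrder A] [StarOrderedRing A]
  [NormedAddCommGroup H] [InnerProductSpace ℂ H] [CompleteSpace H]

lemma one_sub_star_mul_self_nonneg {a : A} (ha : ‖a‖ ≤ 1) : 0 ≤ 1 - star a * a := by
  refine sub_nonneg.mpr (CStarAlgebra.star_mul_le_algebraMap_norm_sq.trans ?_)
  rw [← map_one (algebraMap ℝ A)]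
  exact algebraMap_mono A (pow_le_one₀ (norm_nonneg _) ha)

/-- A contractive matrix of operators defines a contractive form on tuples of vectors. -/
lemma neg_le_two_re_sum_inner {n : Type*} [Fintype n] [DecidableEq n]
    {N : CStarMatrix n n (H →L[ℂ] H)} (hN : ‖N‖ ≤ 1) (h k : n → H) :
    -(∑ i, ‖h i‖ ^ 2 + ∑ j, ‖k j‖ ^ 2) ≤ 2 * (∑ i, ∑ j, ⟪h i, N i j (k j)⟫_ℂ).re := by
  set w : n → H := fun i => ∑ j, N i j (k j) with hw
  have h1 : ∑ i, ‖w i‖ ^ 2 ≤ ∑ j, ‖k j‖ ^ 2 := by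
    have h0 := re_sum_inner_nonneg (one_sub_star_mul_self_nonneg hN) k
    have e1 : ∑ i, ∑ j, ⟪k i, (1 - star N * N) i j (k j)⟫_ℂ
        = ∑ i, ⟪k i, k i⟫_ℂ - ∑ r, ⟪w r, w r⟫_ℂ := by
      have entry (i j) : ⟪k i, (1 - star N * N) i j (k j)⟫_ℂ
          = (if i = j then ⟪k i, k i⟫_ℂ else 0) - ∑ r, ⟪N r i (k i), N r j (k j)⟫_ℂ := by
        rw [CStarMatrix.sub_apply, _root_.sub_apply, inner_sub_right]
        congr 1
        · rw [CStarMatrix.one_apply]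
          split_ifs with hij
          · subst hij; rfl
          · simp
        · rw [CStarMatrix.mul_apply, _root_.sum_apply, inner_sum]
          refine Finset.sum_congr rfl fun r _ => ?_
          change ⟪k i, ((ContinuousLinearMap.adjoint (N r i)) ∘L (N r j)) (k j)⟫_ℂ = _
          rw [ContinuousLinearMap.comp_apply, ContinuousLinearMap.adjoint_inner_right]
      simp only [entry, Finset.sum_sub_distrib, Finset.sum_ite_eq, Finset.mem_univ, if_true, hw,
        sum_inner, inner_sum]
      congr 1
      rw [Finset.sum_comm]
      conv_rhs => rw [Finset.sum_comm]
      refine Finset.sum_congr rfl fun i _ => ?_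
      rw [Finset.sum_comm]
    rw [e1, Complex.sub_re, Complex.re_sum, Complex.re_sum] at h0
    have e2 (x : H) : (⟪x, x⟫_ℂ).re = ‖x‖ ^ 2 := inner_self_eq_norm_sq (𝕜 := ℂ) x
    simp only [e2] at h0
    linarith
  have h2 : (∑ i, ∑ j, ⟪h i, N i j (k j)⟫_ℂ).re = ∑ i, (⟪h i, w i⟫_ℂ).re := by
    simp only [hw, inner_sum, Complex.re_sum]
  rw [h2, Finset.mul_sum]
  have h3 (i) : -(‖h i‖ ^ 2 + ‖w i‖ ^ 2) ≤ 2 * (⟪h i, w i⟫_ℂ).re := by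
    have := @norm_add_sq ℂ _ _ _ _ (h i) (w i)
    have h4 := sq_nonneg ‖h i + w i‖
    rw [RCLike.re_eq_complex_re] at this
    linarith
  calc -(∑ i, ‖h i‖ ^ 2 + ∑ j, ‖k j‖ ^ 2) ≤ -(∑ i, ‖h i‖ ^ 2 + ∑ i, ‖w i‖ ^ 2) := by linarith
    _ = ∑ i, -(‖h i‖ ^ 2 + ‖w i‖ ^ 2) := by
      rw [Finset.sum_neg_distrib, Finset.sum_add_distrib]
    _ ≤ _ := Finset.sum_le_sum fun i _ => h3 i

lemma norm_map_le_one {φ : A →ₗ[ℂ] (H →L[ℂ] H)} (hφ : cbENorm φ ≤ 1) {k : ℕ}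
    {M : CStarMatrix (Fin k) (Fin k) A} (hM : ‖M‖ ≤ 1) : ‖M.map φ‖ ≤ 1 := by
  have : ‖M.map φ‖ₑ ≤ 1 :=
    (le_iSup_of_le k (le_iSup₂_of_le M hM le_rfl) : ‖M.map φ‖ₑ ≤ cbENorm φ).trans hφ
  rw [← ofReal_norm] at this
  exact ENNReal.ofReal_le_one.mp this

/-- The norm of `CStarMatrix` is the operator norm of right multiplication on row vectors. -/
lemma cstarMatrix_norm_le_one {n : Type*} [Fintype n] (M : CStarMatrix n n A)
    (h : ∀ v : n → A, (v ᵥ* (M : Matrix n n A)) ⬝ᵥ star (v ᵥ* (M : Matrix n n A)) ≤ v ⬝ᵥ star v) :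
    ‖M‖ ≤ 1 := by
  rw [CStarMatrix.norm_def]
  refine ContinuousLinearMap.opNorm_le_bound _ zero_le_one fun v => ?_
  rw [one_mul, ← sq_le_sq₀ (norm_nonneg _) (norm_nonneg _), WithCStarModule.pi_norm_sq,
    WithCStarModule.pi_norm_sq]
  refine CStarAlgebra.norm_le_norm_of_nonneg_of_le ?_ ?_
  · exact Finset.sum_nonneg fun _ _ => CStarModule.inner_self_nonneg
  · exact h fun i => v i

open scoped MatrixOrder ComplexOrder in
lemma exists_isUnit_conjTranspose_mul_self {n : Type*} [Fintype n] [DecidableEq n]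
    {C : Matrix n n ℂ} (hC : C.PosDef) : ∃ B : Matrix n n ℂ, IsUnit B ∧ C = Bᴴ * B := by
  obtain ⟨B, hB⟩ := CStarAlgebra.nonneg_iff_eq_star_mul_self.mp hC.posSemidef.nonneg
  refine ⟨B, ?_, hB⟩
  have := hC.isUnit
  rw [hB] at this
  exact isUnit_of_mul_isUnit_right this

lemma star_dotProduct_mulVec {R n : Type*} [Fintype n] [NonUnitalSemiring R] [StarRing R]
    (M : Matrix n n R) (y z : n → R) : star (star y ⬝ᵥ M *ᵥ z) = star z ⬝ᵥ Mᴴ *ᵥ y := by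
  rw [← Matrix.star_dotProduct, Matrix.star_mulVec, Matrix.dotProduct_mulVec]

lemma star_dotProduct_conjTranspose_mul_mulVec {R n : Type*} [Fintype n] [NonUnitalSemiring R]
    [StarRing R] (B M C : Matrix n n R) (y z : n → R) :
    star y ⬝ᵥ (Bᴴ * M * C) *ᵥ z = star (B *ᵥ y) ⬝ᵥ M *ᵥ (C *ᵥ z) := by
  rw [Matrix.star_mulVec, ← Matrix.dotProduct_mulVec, Matrix.mulVec_mulVec, Matrix.mulVec_mulVec,
    Matrix.mul_assoc]

lemma star_dotProduct_self_nonneg {n : Type*} [Fintype n] (y : n → A) : 0 ≤ star y ⬝ᵥ y :=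
  Finset.sum_nonneg fun i _ => star_mul_self_nonneg (y i)

lemma nonneg_of_smul_one_nonneg [Nontrivial A] {r : ℝ} (h : 0 ≤ r • (1 : A)) : 0 ≤ r := by
  by_contra! hr
  have h1 : r • (1 : A) ≤ 0 := smul_nonpos_of_nonpos_of_nonneg hr.le zero_le_one
  have h2 := le_antisymm h1 h
  rcases smul_eq_zero.mp h2 with h3 | h3
  · exact hr.ne h3
  · exact one_ne_zero h3

open scoped ComplexOrder in
/-- Positivity of a scalar matrix over `A` is tested on scalar vectors. -/
lemma posSemidef_of_scalarMat [Nontrivial A] {n : Type*} [Fintype n] (α : Matrix n n ℂ)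
    (h : ∀ y : n → A, 0 ≤ star y ⬝ᵥ scalarMat A (α + αᴴ) *ᵥ y) : (α + αᴴ).PosSemidef := by
  have hherm : (α + αᴴ).IsHermitian := by
    rw [Matrix.IsHermitian, Matrix.conjTranspose_add, Matrix.conjTranspose_conjTranspose, add_comm]
  refine .of_dotProduct_mulVec_nonneg hherm fun c => ?_
  have him : star (star c ⬝ᵥ (α + αᴴ) *ᵥ c) = star c ⬝ᵥ (α + αᴴ) *ᵥ c := by
    rw [star_dotProduct_mulVec, hherm]
  obtain ⟨r, hr⟩ := Complex.conj_eq_iff_real.mp him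
  have key : star (fun i => algebraMap ℂ A (c i)) ⬝ᵥ scalarMat A (α + αᴴ) *ᵥ
      (fun i => algebraMap ℂ A (c i)) = algebraMap ℂ A (star c ⬝ᵥ (α + αᴴ) *ᵥ c) := by
    simp only [dotProduct, Matrix.mulVec, scalarMat, map_sum, map_mul, Pi.star_apply,
      Matrix.map_apply]
    refine Finset.sum_congr rfl fun i _ => ?_
    congr 1
    simp [Algebra.algebraMap_eq_smul_one]
  have h0 := h fun i => algebraMap ℂ A (c i)
  rw [key, hr, Algebra.algebraMap_eq_smul_one, Complex.coe_smul] at h0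
  rw [hr]
  exact Complex.zero_le_real.mpr (nonneg_of_smul_one_nonneg h0)

lemma sum_norm_sq_orthonormal {H : Type*} [NormedAddCommGroup H] [InnerProductSpace ℂ H] {k : ℕ}
    {e : Fin k → H} (he : Orthonormal ℂ e)
    (a : Matrix (Fin k) (Fin k) ℂ) :
    ∑ r, ‖∑ i, a r i • e i‖ ^ 2 = (aᴴ * a).trace.re := by
  have h1 (r) : ‖∑ i, a r i • e i‖ ^ 2 = (∑ i, star (a r i) * a r i).re := by
    rw [@norm_sq_eq_re_inner ℂ, he.inner_sum]; rfl
  simp only [h1]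
  rw [← Complex.re_sum, Finset.sum_comm]
  rfl

open scoped ComplexOrder in
/-- The positivity underlying Paulsen's off-diagonal trick: if the matrix `[α, X; 0, β]` over `A`,
with scalar diagonal blocks, has nonnegative real part, and `φ` is completely contractive, then
`tr α + tr β + ∑ ⟪eᵢ, φ(Xᵢⱼ) eⱼ⟫` has nonnegative real part. Up to a perturbation making them
invertible, `α + αᴴ = a⋆ a` and `β + βᴴ = b⋆ b`; then `X = a⋆ M b` with a contraction `M`, and the
vectors `a e`, `b e` are paired through the contraction `φ(M)`. -/
theorem re_trace_add_nonneg [Nontrivial A] {φ : A →ₗ[ℂ] (H →L[ℂ] H)} (hφ : cbENorm φ ≤ 1) {k : ℕ}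
    {e : Fin k → H} (he : Orthonormal ℂ e) (α β : Matrix (Fin k) (Fin k) ℂ)
    (X : Matrix (Fin k) (Fin k) A)
    (h : ∀ y z : Fin k → A, 0 ≤
      (star y ⬝ᵥ scalarMat A α *ᵥ y + star z ⬝ᵥ scalarMat A β *ᵥ z + star y ⬝ᵥ X *ᵥ z) +
      star (star y ⬝ᵥ scalarMat A α *ᵥ y + star z ⬝ᵥ scalarMat A β *ᵥ z + star y ⬝ᵥ X *ᵥ z)) :
    0 ≤ (α.trace + β.trace + ∑ i, ∑ j, ⟪e i, φ (X i j) (e j)⟫_ℂ).re := by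
  -- pass to the hermitian parts of the diagonal blocks
  have herm (γ : Matrix (Fin k) (Fin k) ℂ) (y : Fin k → A) :
      star y ⬝ᵥ scalarMat A γ *ᵥ y + star (star y ⬝ᵥ scalarMat A γ *ᵥ y)
        = star y ⬝ᵥ scalarMat A (γ + γᴴ) *ᵥ y := by
    rw [star_dotProduct_mulVec, ← scalarMat_conjTranspose, scalarMat_add, Matrix.add_mulVec,
      dotProduct_add]
  have h1 (y z : Fin k → A) : 0 ≤ star y ⬝ᵥ scalarMat A (α + αᴴ) *ᵥ y
      + star z ⬝ᵥ scalarMat A (β + βᴴ) *ᵥ z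
      + (star y ⬝ᵥ X *ᵥ z + star (star y ⬝ᵥ X *ᵥ z)) := by
    rw [← herm, ← herm]
    refine (h y z).trans_eq ?_
    rw [star_add, star_add]
    abel
  have hα : (α + αᴴ).PosSemidef := posSemidef_of_scalarMat (A := A) α fun y => by
    simpa using h1 y 0
  have hβ : (β + βᴴ).PosSemidef := posSemidef_of_scalarMat (A := A) β fun y => by
    simpa using h1 0 y
  refine le_of_forall_pos_le_add fun δ hδ => ?_
  obtain ⟨ε, hε, hεδ⟩ : ∃ ε : ℝ, 0 < ε ∧ ε * k ≤ δ :=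
    ⟨δ / (k + 1), by positivity, by
      rw [div_mul_eq_mul_div, div_le_iff₀ (by positivity)]; nlinarith⟩
  have hpos {γ : Matrix (Fin k) (Fin k) ℂ} (hγ : (γ + γᴴ).PosSemidef) :
      (γ + γᴴ + (ε : ℂ) • (1 : Matrix (Fin k) (Fin k) ℂ)).PosDef :=
    Matrix.PosDef.posSemidef_add hγ (Matrix.PosDef.one.smul (by exact_mod_cast hε))
  obtain ⟨a, ha, hαa⟩ := exists_isUnit_conjTranspose_mul_self (hpos hα)
  obtain ⟨b, hb, hβb⟩ := exists_isUnit_conjTranspose_mul_self (hpos hβ)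
  obtain ⟨a', haa', ha'a⟩ := isUnit_iff_exists.mp ha
  obtain ⟨b', hbb', hb'b⟩ := isUnit_iff_exists.mp hb
  set M : Matrix (Fin k) (Fin k) A := (scalarMat A a')ᴴ * X * scalarMat A b' with hM
  have hXM : X = (scalarMat A a)ᴴ * M * scalarMat A b := by
    have e1 : (scalarMat A a)ᴴ * (scalarMat A a')ᴴ = 1 := by
      rw [← Matrix.conjTranspose_mul, ← scalarMat_mul, ha'a, scalarMat_one,
        Matrix.conjTranspose_one]
    have e2 : scalarMat A b' * scalarMat A b = 1 := by
      rw [← scalarMat_mul, hb'b, scalarMat_one]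
    rw [hM, Matrix.mul_assoc, Matrix.mul_assoc, Matrix.mul_assoc, e2, Matrix.mul_one,
      ← Matrix.mul_assoc, e1, Matrix.one_mul]
  -- after the change of variables, `X` becomes the contraction `M`
  have hle {γ c : Matrix (Fin k) (Fin k) ℂ}
      (hc : γ + γᴴ + (ε : ℂ) • (1 : Matrix (Fin k) (Fin k) ℂ) = cᴴ * c) (y : Fin k → A) :
      star y ⬝ᵥ scalarMat A (γ + γᴴ) *ᵥ y
        ≤ star (scalarMat A c *ᵥ y) ⬝ᵥ (scalarMat A c *ᵥ y) := by
    have e1 : star (scalarMat A c *ᵥ y) ⬝ᵥ (scalarMat A c *ᵥ y)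
        = star y ⬝ᵥ scalarMat A (γ + γᴴ) *ᵥ y + ε • (star y ⬝ᵥ y) := by
      have := star_dotProduct_conjTranspose_mul_mulVec (scalarMat A c) 1 (scalarMat A c) y y
      rw [Matrix.one_mulVec, Matrix.mul_one, ← scalarMat_conjTranspose, ← scalarMat_mul, ← hc,
        scalarMat_add, Matrix.add_mulVec, dotProduct_add] at this
      rw [← this]
      congr 1
      have e3 : scalarMat A ((ε : ℂ) • (1 : Matrix (Fin k) (Fin k) ℂ)) = (ε : ℝ) • 1 := by
        ext i j
        rw [scalarMat, Matrix.map_apply, Matrix.smul_apply, Matrix.smul_apply, Matrix.one_apply,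
          Matrix.one_apply]
        split_ifs <;> simp [Algebra.algebraMap_eq_smul_one]
      rw [e3, Matrix.smul_mulVec, Matrix.one_mulVec, dotProduct_smul]
    rw [e1]
    exact le_add_of_nonneg_right (smul_nonneg hε.le (star_dotProduct_self_nonneg y))
  have h2 (y z : Fin k → A) : 0 ≤ star y ⬝ᵥ y + star z ⬝ᵥ z
      + (star y ⬝ᵥ M *ᵥ z + star (star y ⬝ᵥ M *ᵥ z)) := by
    have inv {c c' : Matrix (Fin k) (Fin k) ℂ} (hc : c * c' = 1) (y : Fin k → A) :
        scalarMat A c *ᵥ (scalarMat A c' *ᵥ y) = y := by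
      rw [Matrix.mulVec_mulVec, ← scalarMat_mul, hc, scalarMat_one, Matrix.one_mulVec]
    refine (h1 (scalarMat A a' *ᵥ y) (scalarMat A b' *ᵥ z)).trans ?_
    refine add_le_add (add_le_add ?_ ?_) (le_of_eq ?_)
    · exact (hle hαa _).trans_eq (by rw [inv haa'])
    · exact (hle hβb _).trans_eq (by rw [inv hbb'])
    · rw [hM, star_dotProduct_conjTranspose_mul_mulVec]
  have hMnorm : ‖CStarMatrix.ofMatrix M‖ ≤ 1 := by
    refine cstarMatrix_norm_le_one _ fun v => ?_
    change (v ᵥ* M) ⬝ᵥ star (v ᵥ* M) ≤ v ⬝ᵥ star v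
    have h3 := h2 (star v) (-star (v ᵥ* M))
    have e1 : star (star v) ⬝ᵥ M *ᵥ (-star (v ᵥ* M)) = -((v ᵥ* M) ⬝ᵥ star (v ᵥ* M)) := by
      rw [star_star, Matrix.mulVec_neg, dotProduct_neg, Matrix.dotProduct_mulVec]
    have e2 : star ((v ᵥ* M) ⬝ᵥ star (v ᵥ* M)) = (v ᵥ* M) ⬝ᵥ star (v ᵥ* M) := by
      rw [← Matrix.dotProduct_star]
    have e3 : star (-star (v ᵥ* M)) ⬝ᵥ (-star (v ᵥ* M)) = (v ᵥ* M) ⬝ᵥ star (v ᵥ* M) := by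
      rw [star_neg, neg_dotProduct_neg, star_star]
    rw [e1, e3, star_neg, e2, star_star] at h3
    refine sub_nonneg.mp (h3.trans_eq ?_)
    abel
  have hmain := neg_le_two_re_sum_inner (norm_map_le_one hφ hMnorm)
    (fun r => ∑ i, a r i • e i) (fun s => ∑ j, b s j • e j)
  have hsum : ∑ i, ∑ j, ⟪e i, φ (X i j) (e j)⟫_ℂ
      = ∑ r, ∑ s, ⟪∑ i, a r i • e i, φ (M r s) (∑ j, b s j • e j)⟫_ℂ := by
    have entry (i j) : ⟪e i, φ (X i j) (e j)⟫_ℂ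
        = ∑ s, ∑ r, star (a r i) * (b s j * ⟪e i, φ (M r s) (e j)⟫_ℂ) := by
      have hX : X i j = ∑ s, ∑ r, (star (a r i) * b s j) • M r s := by
        rw [hXM]
        simp only [Matrix.mul_apply, Finset.sum_mul]
        refine Finset.sum_congr rfl fun s _ => Finset.sum_congr rfl fun r _ => ?_
        simp [scalarMat, Algebra.algebraMap_eq_smul_one, smul_smul, mul_comm]
      rw [hX]
      simp only [map_sum, map_smul, _root_.sum_apply, _root_.smul_apply, inner_sum,
        inner_smul_right, mul_assoc]
    have entry' (r s) : ⟪∑ i, a r i • e i, φ (M r s) (∑ j, b s j • e j)⟫_ℂ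
        = ∑ i, ∑ j, star (a r i) * (b s j * ⟪e i, φ (M r s) (e j)⟫_ℂ) := by
      simp only [sum_inner, map_sum, map_smul, inner_sum, inner_smul_left, inner_smul_right]
      simp only [Finset.mul_sum]
      rw [Finset.sum_comm]
      refine Finset.sum_congr rfl fun i _ => Finset.sum_congr rfl fun j _ => ?_
      exact mul_left_comm _ _ _
    simp only [entry, entry']
    rw [Finset.sum_congr rfl fun i _ => Finset.sum_comm, Finset.sum_comm]
    rw [Finset.sum_congr rfl fun s _ =>
      (Finset.sum_congr rfl fun i _ => Finset.sum_comm).trans Finset.sum_comm]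
    exact Finset.sum_comm
  have e4 : (CStarMatrix.ofMatrix M).map φ = fun r s => φ (M r s) := rfl
  have htr {γ c : Matrix (Fin k) (Fin k) ℂ}
      (hc : γ + γᴴ + (ε : ℂ) • (1 : Matrix (Fin k) (Fin k) ℂ) = cᴴ * c) :
      ∑ r, ‖∑ i, c r i • e i‖ ^ 2 = 2 * γ.trace.re + ε * k := by
    rw [sum_norm_sq_orthonormal he, ← hc, Matrix.trace_add, Matrix.trace_add,
      Matrix.trace_conjTranspose, Matrix.trace_smul, Matrix.trace_one]
    simp
    ring
  rw [htr hαa, htr hβb, e4] at hmain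
  simp only [Complex.add_re]
  rw [hsum]
  linarith

end MatrixInequality

/-! ### Factorization of completely contractive maps -/

section Extension

open scoped InnerProductSpace Matrix

variable {A : Type u} [CStarAlgebra A] {ι : Type v}

/-- The evaluation `U ↦ ∑ yᵢ⋆ Uᵢⱼ zⱼ` of a finitely supported matrix over `A`. -/
def blockForm (y z : ι → A) : ((ι × ι) →₀ A) →ₗ[ℂ] A :=
  Finsupp.lsum ℂ fun p => LinearMap.mulLeftRight ℂ (star (y p.1), z p.2)

lemma blockForm_apply (y z : ι → A) (U : (ι × ι) →₀ A) :
    blockForm y z U = U.sum fun p a => star (y p.1) * a * z p.2 := rfl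

@[simp] lemma blockForm_single (y z : ι → A) (p : ι × ι) (a : A) :
    blockForm y z (Finsupp.single p a) = star (y p.1) * a * z p.2 := by
  simp [blockForm_apply]

/-- Finitely supported scalar matrices as matrices over `A`. -/
def scalarBlock (A : Type u) [CStarAlgebra A] (ι : Type v) :
    ((ι × ι) →₀ ℂ) →ₗ[ℂ] ((ι × ι) →₀ A) :=
  Finsupp.mapRange.linearMap (Algebra.linearMap ℂ A)

@[simp] lemma scalarBlock_single (p : ι × ι) (c : ℂ) :
    scalarBlock A ι (Finsupp.single p c) = Finsupp.single p (algebraMap ℂ A c) := by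
  simp [scalarBlock]

/-- The space of tuples `(U₁, U₂, X, α, β)`: two diagonal blocks over `A`, one off-diagonal block
over `A`, and two scalar diagonal blocks. The scalar blocks are kept apart from `U₁` and `U₂`, so
that the matrices with scalar diagonal are cut out by `U₁ = U₂ = 0`. -/
abbrev BlockSpace (A : Type u) [CStarAlgebra A] (ι : Type v) : Type (max u v) :=
  ((ι × ι) →₀ A) × ((ι × ι) →₀ A) × ((ι × ι) →₀ A) × ((ι × ι) →₀ ℂ) × ((ι × ι) →₀ ℂ)

/-- The evaluation of the operator matrix `[U₁ + α, X; 0, U₂ + β]` at the vector `(y, z)`. -/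
def pairForm (y z : ι → A) : BlockSpace A ι →ₗ[ℂ] A where
  toFun x := blockForm y y (x.1 + scalarBlock A ι x.2.2.2.1)
    + blockForm z z (x.2.1 + scalarBlock A ι x.2.2.2.2) + blockForm y z x.2.2.1
  map_add' x x' := by
    simp only [Prod.fst_add, Prod.snd_add, map_add]
    abel
  map_smul' c x := by
    simp only [Prod.smul_fst, Prod.smul_snd, map_smul, map_add, smul_add, RingHom.id_apply]

lemma pairForm_apply (y z : ι → A) (x : BlockSpace A ι) :
    pairForm y z x = blockForm y y (x.1 + scalarBlock A ι x.2.2.2.1)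
      + blockForm z z (x.2.1 + scalarBlock A ι x.2.2.2.2) + blockForm y z x.2.2.1 := rfl

/-- Reduction of a finitely supported sum over pairs to a finite square. -/
lemma finsupp_sum_eq_sum_fin {B N : Type*} [Zero B] [AddCommMonoid N] {F : Finset ι}
    {U : (ι × ι) →₀ B} (hU : U.support ⊆ F ×ˢ F) (G : ι × ι → B → N) (hG : ∀ p, G p 0 = 0) :
    U.sum G = ∑ i, ∑ j, G (F.equivFin.symm i, F.equivFin.symm j)
      (U (F.equivFin.symm i, F.equivFin.symm j)) := by
  rw [Finsupp.sum_of_support_subset _ hU _ (fun p _ => hG p), Finset.sum_product,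
    ← Finset.sum_coe_sort, ← F.equivFin.symm.sum_comp]
  refine Finset.sum_congr rfl fun i _ => ?_
  rw [← Finset.sum_coe_sort, ← F.equivFin.symm.sum_comp]

/-- The finite submatrix of a matrix supported on `F × F`. -/
def finMat {B : Type*} (F : Finset ι) (U : ι × ι → B) : Matrix (Fin F.card) (Fin F.card) B :=
  Matrix.of fun i j => U (F.equivFin.symm i, F.equivFin.symm j)

variable {H : Type v} [NormedAddCommGroup H] [InnerProductSpace ℂ H]

/-- The trace of a finitely supported scalar matrix. -/
def finTrace (ι : Type v) : ((ι × ι) →₀ ℂ) →ₗ[ℂ] ℂ :=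
  open Classical in Finsupp.lsum ℂ fun p => if p.1 = p.2 then LinearMap.id else 0

lemma finTrace_apply [DecidableEq ι] (α : (ι × ι) →₀ ℂ) :
    finTrace ι α = α.sum fun p c => if p.1 = p.2 then c else 0 := by
  simp only [finTrace, Finsupp.lsum_apply]
  congr 1; ext p c
  split_ifs <;> simp_all

/-- The pairing `X ↦ ∑ ⟪eᵢ, φ(Xᵢⱼ) eⱼ⟫`. -/
def mapPairing (e : ι → H) (φ : A →ₗ[ℂ] (H →L[ℂ] H)) : ((ι × ι) →₀ A) →ₗ[ℂ] ℂ :=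
  Finsupp.lsum ℂ fun p => (innerSL ℂ (e p.1)).toLinearMap ∘ₗ
    (ContinuousLinearMap.apply ℂ H (e p.2)).toLinearMap ∘ₗ φ

lemma mapPairing_apply (e : ι → H) (φ : A →ₗ[ℂ] (H →L[ℂ] H)) (X : (ι × ι) →₀ A) :
    mapPairing e φ X = X.sum fun p a => ⟪e p.1, φ a (e p.2)⟫_ℂ := rfl

/-- The functional `Re (tr α + tr β + ∑ ⟪eᵢ, φ(Xᵢⱼ) eⱼ⟫)`; it is relevant only where
`U₁ = U₂ = 0`. -/
def baseFunctional (e : ι → H) (φ : A →ₗ[ℂ] (H →L[ℂ] H)) : BlockSpace A ι →ₗ[ℝ] ℝ where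
  toFun x := (finTrace ι x.2.2.2.1 + finTrace ι x.2.2.2.2 + mapPairing e φ x.2.2.1).re
  map_add' x x' := by
    simp only [Prod.fst_add, Prod.snd_add, map_add, Complex.add_re]
    ring
  map_smul' c x := by
    simp only [Prod.smul_fst, Prod.smul_snd, LinearMap.map_smul_of_tower, ← smul_add,
      Complex.smul_re, RingHom.id_apply]

variable [PartialOrder A] [StarOrderedRing A]

variable (A ι) in
/-- The cone of block matrices whose real part is positive. -/
def blockCone : PointedCone ℝ (BlockSpace A ι) where
  carrier := {x | ∀ y z : ι → A, 0 ≤ pairForm y z x + star (pairForm y z x)}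
  add_mem' {a b} ha hb y z := by
    rw [map_add, star_add, add_add_add_comm]
    exact add_nonneg (ha y z) (hb y z)
  zero_mem' y z := by simp
  smul_mem' c x hx y z := by
    have : pairForm y z (c • x) = (c : ℝ) • pairForm y z x :=
      LinearMap.map_smul_of_tower (pairForm y z) (c : ℝ) x
    rw [this, star_smul, star_trivial, ← smul_add]
    exact smul_nonneg c.2 (hx y z)

lemma mem_blockCone {x : BlockSpace A ι} :
    x ∈ blockCone A ι ↔ ∀ y z : ι → A, 0 ≤ pairForm y z x + star (pairForm y z x) := Iff.rfl

/-- Every finitely supported matrix is dominated by a scalar one: each entry `a` at `(i, j)` is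
dominated by `1 + ‖a‖²` at `(i, i)` and `(j, j)`. -/
lemma exists_scalarBlock_dominating (U : (ι × ι) →₀ A) :
    ∃ α : (ι × ι) →₀ ℂ, ∀ y : ι → A, 0 ≤ blockForm y y (U + scalarBlock A ι α)
      + star (blockForm y y (U + scalarBlock A ι α)) := by
  induction U using Finsupp.induction_linear with
  | zero => exact ⟨0, fun y => by simp⟩
  | add U U' hU hU' =>
    obtain ⟨α, hα⟩ := hU
    obtain ⟨α', hα'⟩ := hU'
    refine ⟨α + α', fun y => ?_⟩
    rw [map_add (scalarBlock A ι), add_add_add_comm, map_add, star_add, add_add_add_comm]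
    exact add_nonneg (hα y) (hα' y)
  | single p a =>
    obtain ⟨i, j⟩ := p
    set c : ℝ := 1 + ‖a‖ ^ 2 with hc
    refine ⟨Finsupp.single (i, i) (c : ℂ) + Finsupp.single (j, j) (c : ℂ), fun y => ?_⟩
    have e : blockForm y y (Finsupp.single (i, j) a + scalarBlock A ι
        (Finsupp.single (i, i) (c : ℂ) + Finsupp.single (j, j) (c : ℂ)))
        = star (y i) * a * y j + c • (star (y i) * y i) + c • (star (y j) * y j) := by
      simp [Algebra.algebraMap_eq_smul_one, add_assoc]
    rw [e]
    have h1 : 0 ≤ star (star a * y i + y j) * (star a * y i + y j) := star_mul_self_nonneg _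
    have h2 : star (y i) * (a * star a) * y i ≤ ‖a‖ ^ 2 • (star (y i) * y i) := by
      have := CStarAlgebra.star_left_conjugate_le_norm_smul (a := y i) (b := a * star a)
      rwa [CStarRing.norm_self_mul_star, ← sq] at this
    have h3 : 0 ≤ (1 + c) • (star (y i) * y i) :=
      smul_nonneg (by positivity) (star_mul_self_nonneg _)
    have h4 : 0 ≤ (c + ‖a‖ ^ 2) • (star (y j) * y j) :=
      smul_nonneg (by positivity) (star_mul_self_nonneg _)
    have e2 : (star (y i) * a * y j + c • (star (y i) * y i) + c • (star (y j) * y j))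
        + star (star (y i) * a * y j + c • (star (y i) * y i) + c • (star (y j) * y j))
        = star (star a * y i + y j) * (star a * y i + y j)
          + (‖a‖ ^ 2 • (star (y i) * y i) - star (y i) * (a * star a) * y i)
          + (1 + c) • (star (y i) * y i) + (c + ‖a‖ ^ 2) • (star (y j) * y j) := by
      simp only [star_add, star_mul, star_star, star_smul, star_trivial, hc, add_smul, one_smul,
        mul_add, add_mul, mul_assoc]
      abel
    rw [e2]
    exact add_nonneg (add_nonneg (add_nonneg h1 (sub_nonneg.mpr h2)) h3) h4

variable [CompleteSpace H]

/-- The base functional is nonnegative on the block matrices `[α, X; 0, β]` with positive real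
part. -/
lemma baseFunctional_nonneg [Nontrivial A] {e : ι → H} (he : Orthonormal ℂ e)
    {φ : A →ₗ[ℂ] (H →L[ℂ] H)} (hφ : cbENorm φ ≤ 1) {x : BlockSpace A ι} (hx : x ∈ blockCone A ι)
    (h1 : x.1 = 0) (h2 : x.2.1 = 0) : 0 ≤ baseFunctional e φ x := by
  classical
  obtain ⟨U₁, U₂, X, α, β⟩ := x
  obtain rfl : U₁ = 0 := h1
  obtain rfl : U₂ = 0 := h2
  let S : Finset (ι × ι) := X.support ∪ α.support ∪ β.support
  let F : Finset ι := S.image Prod.fst ∪ S.image Prod.snd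
  have hS {p} (hp : p ∈ S) : p ∈ F ×ˢ F :=
    Finset.mem_product.mpr ⟨Finset.mem_union_left _ (Finset.mem_image_of_mem _ hp),
      Finset.mem_union_right _ (Finset.mem_image_of_mem _ hp)⟩
  have hX : X.support ⊆ F ×ˢ F := fun p hp => hS (by simp only [S, Finset.mem_union]; tauto)
  have hα : α.support ⊆ F ×ˢ F := fun p hp => hS (by simp only [S, Finset.mem_union]; tauto)
  have hβ : β.support ⊆ F ×ˢ F := fun p hp => hS (by simp only [S, Finset.mem_union]; tauto)
  let idx : Fin F.card → ι := fun i => F.equivFin.symm i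
  have hidx : Function.Injective idx := Subtype.val_injective.comp F.equivFin.symm.injective
  have hblock (y z : Fin F.card → A) {U : (ι × ι) →₀ A} (hU : U.support ⊆ F ×ˢ F) :
      blockForm (Function.extend idx y 0) (Function.extend idx z 0) U
        = star y ⬝ᵥ finMat F U *ᵥ z := by
    rw [blockForm_apply, finsupp_sum_eq_sum_fin hU _ (by simp)]
    simp only [dotProduct, Matrix.mulVec, Finset.mul_sum]
    refine Finset.sum_congr rfl fun i _ => Finset.sum_congr rfl fun j _ => ?_
    change star (Function.extend idx y 0 (idx i)) * _ * Function.extend idx z 0 (idx j) = _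
    rw [hidx.extend_apply, hidx.extend_apply, mul_assoc]
    rfl
  have hscalar {γ : (ι × ι) →₀ ℂ} (hγ : γ.support ⊆ F ×ˢ F) :
      (scalarBlock A ι γ).support ⊆ F ×ˢ F :=
    (Finsupp.support_mapRange (hf := map_zero (Algebra.linearMap ℂ A))).trans hγ
  have htrace {γ : (ι × ι) →₀ ℂ} (hγ : γ.support ⊆ F ×ˢ F) : finTrace ι γ = (finMat F γ).trace := by
    rw [finTrace_apply, finsupp_sum_eq_sum_fin hγ _ (by simp)]
    refine Finset.sum_congr rfl fun i _ => ?_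
    have hij (j) : ((F.equivFin.symm i : ι) = F.equivFin.symm j) ↔ i = j := hidx.eq_iff
    simp [hij, finMat]
  have key := re_trace_add_nonneg hφ (he.comp idx hidx) (finMat F α) (finMat F β) (finMat F X)
      fun y z => by
    have := mem_blockCone.mp hx (Function.extend idx y 0) (Function.extend idx z 0)
    rw [pairForm_apply] at this
    simp only [zero_add] at this
    rwa [hblock _ _ hX, hblock _ _ (hscalar hα), hblock _ _ (hscalar hβ)] at this
  change 0 ≤ (finTrace ι α + finTrace ι β + mapPairing e φ X).re
  rw [htrace hα, htrace hβ, mapPairing_apply, finsupp_sum_eq_sum_fin hX _ (by simp)]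
  exact key

end Extension

section HilbertBasis

open scoped InnerProductSpace

variable {ι H : Type*} [NormedAddCommGroup H] [InnerProductSpace ℂ H]

lemma exists_linearIsometry_of_orthonormal (b : HilbertBasis ι ℂ H) {K : Type*}
    [NormedAddCommGroup K] [InnerProductSpace ℂ K] [CompleteSpace K] {v : ι → K}
    (hv : Orthonormal ℂ v) : ∃ V : H →ₗᵢ[ℂ] K, ∀ i, V (b i) = v i := by
  classical
  refine ⟨hv.orthogonalFamily.linearIsometry.comp b.repr.toLinearIsometry, fun i => ?_⟩
  change hv.orthogonalFamily.linearIsometry (b.repr (b i)) = v i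
  rw [b.repr_self, OrthogonalFamily.linearIsometry_apply_single]
  simp

lemma clm_ext_hilbertBasis (b : HilbertBasis ι ℂ H) {S T : H →L[ℂ] H}
    (h : ∀ i j, ⟪b i, S (b j)⟫_ℂ = ⟪b i, T (b j)⟫_ℂ) : S = T := by
  refine ContinuousLinearMap.ext_on
    (Submodule.dense_iff_topologicalClosure_eq_top.mpr b.dense_span) ?_
  rintro _ ⟨j, rfl⟩
  refine b.repr.injective (lp.ext (funext fun i => ?_))
  rw [b.repr_apply_apply, b.repr_apply_apply, h]

end HilbertBasis

section Factorization

open scoped InnerProductSpace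

variable {A : Type u} [CStarAlgebra A] {ι : Type v}

/-- The contribution of a matrix entry `a` at `(p, q)` in the `2 × 2` block picture. Entries of the
lower left block are moved to the upper right block by the involution. -/
def place (A : Type u) [CStarAlgebra A] (ι : Type v) : ι ⊕ ι → ι ⊕ ι → A →ₗ[ℝ] BlockSpace A ι
  | .inl i, .inl j => LinearMap.inl ℝ _ _ ∘ₗ (Finsupp.lsingle (i, j) : A →ₗ[ℝ] _)
  | .inr i, .inr j => LinearMap.inr ℝ _ _ ∘ₗ LinearMap.inl ℝ _ _ ∘ₗ
      (Finsupp.lsingle (i, j) : A →ₗ[ℝ] _)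
  | .inl i, .inr j => LinearMap.inr ℝ _ _ ∘ₗ LinearMap.inr ℝ _ _ ∘ₗ LinearMap.inl ℝ _ _ ∘ₗ
      (Finsupp.lsingle (i, j) : A →ₗ[ℝ] _)
  | .inr j, .inl i => LinearMap.inr ℝ _ _ ∘ₗ LinearMap.inr ℝ _ _ ∘ₗ LinearMap.inl ℝ _ _ ∘ₗ
      (Finsupp.lsingle (i, j) : A →ₗ[ℝ] _) ∘ₗ (starL' ℝ : A ≃L[ℝ] A).toLinearMap

lemma pairForm_place (y z : ι → A) (p q : ι ⊕ ι) (a : A) :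
    pairForm y z (place A ι p q a) + star (pairForm y z (place A ι p q a))
      = star (Sum.elim y z p) * a * Sum.elim y z q
        + star (star (Sum.elim y z p) * a * Sum.elim y z q) := by
  rcases p with i | i <;> rcases q with j | j
  · simp [place, pairForm_apply]
  · simp [place, pairForm_apply]
  · simp [place, pairForm_apply, mul_assoc, add_comm]
  · simp [place, pairForm_apply]

/-- The complex-linear functional on the entries at `(p, q)` whose real part is a given real
functional on block matrices. -/
def blockKernelFun (g : BlockSpace A ι →ₗ[ℝ] ℝ) (p q : ι ⊕ ι) : A →ₗ[ℂ] ℂ :=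
  Module.Dual.extendRCLike (g ∘ₗ place A ι p q)

variable {H : Type v} [NormedAddCommGroup H] [InnerProductSpace ℂ H]

lemma blockKernelFun_inl_inr {e : ι → H} {φ : A →ₗ[ℂ] (H →L[ℂ] H)} {g : BlockSpace A ι →ₗ[ℝ] ℝ}
    (hb : ∀ X α β, g (0, 0, X, α, β) = baseFunctional e φ (0, 0, X, α, β)) (i j : ι) (a : A) :
    blockKernelFun g (.inl i) (.inr j) a = ⟪e i, φ a (e j)⟫_ℂ := by
  have h (a : A) : g (place A ι (.inl i) (.inr j) a) = (⟪e i, φ a (e j)⟫_ℂ).re := by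
    refine (hb (Finsupp.single (i, j) a) 0 0).trans ?_
    simp [baseFunctional, mapPairing_apply]
  simp only [blockKernelFun, Module.Dual.extendRCLike_apply, LinearMap.comp_apply, h]
  apply Complex.ext <;> simp

variable [PartialOrder A] [StarOrderedRing A]

/-- A positive functional depends only on the real part of a block matrix. -/
lemma eq_of_pairForm_eq {g : BlockSpace A ι →ₗ[ℝ] ℝ} (hg : ∀ x ∈ blockCone A ι, 0 ≤ g x)
    {x x' : BlockSpace A ι} (h : ∀ y z, pairForm y z x + star (pairForm y z x)
      = pairForm y z x' + star (pairForm y z x')) : g x = g x' := by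
  have key {x x' : BlockSpace A ι} (h : ∀ y z, pairForm y z x + star (pairForm y z x)
      = pairForm y z x' + star (pairForm y z x')) : g x ≤ g x' := by
    refine sub_nonneg.mp ?_
    rw [← map_sub]
    refine hg _ (mem_blockCone.mpr fun y z => ?_)
    rw [map_sub, star_sub, sub_add_sub_comm, h, sub_self]
  exact le_antisymm (key h) (key fun y z => (h y z).symm)

/-- The positive definite kernel of a positive functional on block matrices. -/
def blockKernel (g : BlockSpace A ι →ₗ[ℝ] ℝ) (hg : ∀ x ∈ blockCone A ι, 0 ≤ g x) :
    PosKernel (ι ⊕ ι) A where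
  toFun := blockKernelFun g
  herm p q a := by
    have h (a : A) : g (place A ι q p (star a)) = g (place A ι p q a) :=
      eq_of_pairForm_eq hg fun y z => by
        rw [pairForm_place, pairForm_place, add_comm]
        simp [mul_assoc]
    have h2 : g (place A ι q p (Complex.I • star a)) = -g (place A ι p q (Complex.I • a)) := by
      rw [← map_neg, ← map_neg, ← h]
      simp
    simp only [blockKernelFun, Module.Dual.extendRCLike_apply, LinearMap.comp_apply,
      RCLike.I_to_complex, h, h2]
    apply Complex.ext <;> simp
  pos m := by
    have hre (p q a) : (blockKernelFun g p q a).re = g (place A ι p q a) :=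
      Module.Dual.re_extendRCLike_apply (𝕜 := ℂ) (g ∘ₗ place A ι p q) a
    simp only [Finsupp.sum, Complex.re_sum, hre, ← map_sum]
    refine hg _ (mem_blockCone.mpr fun y z => ?_)
    have hsum : ∑ p ∈ m.support, ∑ q ∈ m.support,
        star (Sum.elim y z p) * (star (m p) * m q) * Sum.elim y z q
        = star (∑ p ∈ m.support, m p * Sum.elim y z p)
          * ∑ q ∈ m.support, m q * Sum.elim y z q := by
      rw [star_sum, Finset.sum_mul_sum]
      simp only [star_mul, mul_assoc]
    have e : pairForm y z (∑ p ∈ m.support, ∑ q ∈ m.support, place A ι p q (star (m p) * m q))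
        + star (pairForm y z (∑ p ∈ m.support, ∑ q ∈ m.support,
          place A ι p q (star (m p) * m q)))
        = ∑ p ∈ m.support, ∑ q ∈ m.support,
            star (Sum.elim y z p) * (star (m p) * m q) * Sum.elim y z q
          + star (∑ p ∈ m.support, ∑ q ∈ m.support,
            star (Sum.elim y z p) * (star (m p) * m q) * Sum.elim y z q) := by
      simp only [map_sum, star_sum, ← Finset.sum_add_distrib, pairForm_place]
    rw [e, hsum, star_mul, star_star]
    exact add_nonneg (star_mul_self_nonneg _) (star_mul_self_nonneg _)

/-- On the unit, the diagonal blocks of the kernel are those of an orthonormal family. -/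
lemma blockKernelFun_one [DecidableEq ι] {e : ι → H} {φ : A →ₗ[ℂ] (H →L[ℂ] H)}
    {g : BlockSpace A ι →ₗ[ℝ] ℝ}
    (hb : ∀ X α β, g (0, 0, X, α, β) = baseFunctional e φ (0, 0, X, α, β))
    (hg : ∀ x ∈ blockCone A ι, 0 ≤ g x) (i j : ι) :
    blockKernelFun g (.inl i) (.inl j) 1 = (if i = j then 1 else 0) ∧
      blockKernelFun g (.inr i) (.inr j) 1 = if i = j then 1 else 0 := by
  have h1 (c : ℂ) : g (place A ι (.inl i) (.inl j) (c • 1)) = (if i = j then c else 0 : ℂ).re := by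
    have := hb 0 (Finsupp.single (i, j) c) 0
    rw [show baseFunctional e φ (0, 0, 0, Finsupp.single (i, j) c, 0)
      = (if i = j then c else 0 : ℂ).re by simp [baseFunctional, finTrace_apply]] at this
    rw [← this]
    refine eq_of_pairForm_eq hg fun y z => ?_
    rw [pairForm_place, pairForm_apply]
    simp [Algebra.algebraMap_eq_smul_one]
  have h2 (c : ℂ) : g (place A ι (.inr i) (.inr j) (c • 1)) = (if i = j then c else 0 : ℂ).re := by
    have := hb 0 0 (Finsupp.single (i, j) c)
    rw [show baseFunctional e φ (0, 0, 0, 0, Finsupp.single (i, j) c)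
      = (if i = j then c else 0 : ℂ).re by simp [baseFunctional, finTrace_apply]] at this
    rw [← this]
    refine eq_of_pairForm_eq hg fun y z => ?_
    rw [pairForm_place, pairForm_apply]
    simp [Algebra.algebraMap_eq_smul_one]
  have h3 := h1 1
  have h4 := h2 1
  rw [one_smul] at h3 h4
  simp only [blockKernelFun, Module.Dual.extendRCLike_apply, LinearMap.comp_apply,
    RCLike.I_to_complex, h1, h2, h3, h4]
  constructor <;> split_ifs <;> simp

variable [CompleteSpace H]

/-- The functional on block matrices supplied by the M. Riesz extension theorem, which applies
because every block matrix is dominated by one with scalar diagonal. -/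
lemma exists_block_functional [Nontrivial A] {e : ι → H} (he : Orthonormal ℂ e)
    {φ : A →ₗ[ℂ] (H →L[ℂ] H)} (hφ : cbENorm φ ≤ 1) :
    ∃ g : BlockSpace A ι →ₗ[ℝ] ℝ,
      (∀ X α β, g (0, 0, X, α, β) = baseFunctional e φ (0, 0, X, α, β)) ∧
      ∀ x ∈ blockCone A ι, 0 ≤ g x := by
  let D : Submodule ℝ (BlockSpace A ι) := Submodule.prod ⊥ (Submodule.prod ⊥ ⊤)
  have hD (x : BlockSpace A ι) : x ∈ D ↔ x.1 = 0 ∧ x.2.1 = 0 := by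
    simp [D, Submodule.mem_prod]
  obtain ⟨g, hg, hpos⟩ := riesz_extension (blockCone A ι) ((baseFunctional e φ).toPMap D)
    (fun x hx => baseFunctional_nonneg he hφ hx ((hD x).mp x.2).1 ((hD x).mp x.2).2) (by
      rintro ⟨U₁, U₂, X, α, β⟩
      obtain ⟨γ, hγ⟩ := exists_scalarBlock_dominating U₁
      obtain ⟨δ, hδ⟩ := exists_scalarBlock_dominating U₂
      refine ⟨⟨(0, 0, -X, γ - α, δ - β), (hD _).mpr ⟨rfl, rfl⟩⟩, mem_blockCone.mpr fun y z => ?_⟩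
      have e1 : ((0, 0, -X, γ - α, δ - β) + (U₁, U₂, X, α, β) : BlockSpace A ι)
          = (U₁, U₂, 0, γ, δ) := by
        simp
      change 0 ≤ pairForm y z ((0, 0, -X, γ - α, δ - β) + (U₁, U₂, X, α, β) : BlockSpace A ι) +
        star (pairForm y z ((0, 0, -X, γ - α, δ - β) + (U₁, U₂, X, α, β) : BlockSpace A ι))
      rw [e1, pairForm_apply]
      simp only [map_zero, add_zero]
      rw [star_add, add_add_add_comm]
      exact add_nonneg (hγ y) (hδ z))
  exact ⟨g, fun X α β => hg ⟨(0, 0, X, α, β), (hD _).mpr ⟨rfl, rfl⟩⟩, hpos⟩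

/-- Completely contractive maps factor through a representation by two isometries. -/
theorem exists_isometries_of_cbENorm_le_one [Nontrivial A] {φ : A →ₗ[ℂ] (H →L[ℂ] H)}
    (hφ : cbENorm φ ≤ 1) :
    ∃ (K : Type (max u v)) (_ : NormedAddCommGroup K) (_ : InnerProductSpace ℂ K)
      (_ : CompleteSpace K) (π : A →⋆ₐ[ℂ] (K →L[ℂ] K)) (V₁ V₂ : H →ₗᵢ[ℂ] K),
      ∀ a x y, ⟪x, φ a y⟫_ℂ = ⟪V₁ x, π a (V₂ y)⟫_ℂ := by
  classical
  obtain ⟨w, b, -⟩ := exists_hilbertBasis ℂ H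
  obtain ⟨g, hb, hg⟩ := exists_block_functional b.orthonormal hφ
  obtain ⟨K, _, _, _, π, v, hv⟩ := exists_rep_of_posKernel (blockKernel g hg)
  have hv' (p q a) : ⟪v p, π a (v q)⟫_ℂ = blockKernelFun g p q a := hv p q a
  have hv1 (p q) : ⟪v p, v q⟫_ℂ = blockKernelFun g p q 1 := by simpa using hv' p q 1
  obtain ⟨V₁, hV₁⟩ := exists_linearIsometry_of_orthonormal b (v := fun i => v (.inl i))
    (orthonormal_iff_ite.mpr fun i j => (hv1 _ _).trans (blockKernelFun_one hb hg i j).1)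
  obtain ⟨V₂, hV₂⟩ := exists_linearIsometry_of_orthonormal b (v := fun i => v (.inr i))
    (orthonormal_iff_ite.mpr fun i j => (hv1 _ _).trans (blockKernelFun_one hb hg i j).2)
  refine ⟨K, _, _, ‹_›, π, V₁, V₂, fun a x y => ?_⟩
  have : φ a = ContinuousLinearMap.adjoint V₁.toContinuousLinearMap ∘L π a ∘L
      V₂.toContinuousLinearMap := by
    refine clm_ext_hilbertBasis b fun i j => ?_
    simp only [ContinuousLinearMap.comp_apply, ContinuousLinearMap.adjoint_inner_right,
      LinearIsometry.coe_toContinuousLinearMap]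
    rw [hV₁, hV₂, hv', blockKernelFun_inl_inr hb]
  rw [this]
  simp [ContinuousLinearMap.adjoint_inner_right]

end Factorization

/-! ### A universal regular model -/

section HilbertSum

open scoped InnerProductSpace

variable {A : Type*} [CStarAlgebra A] {I : Type*} {K : I → Type*}
  [∀ i, NormedAddCommGroup (K i)] [∀ i, InnerProductSpace ℂ (K i)] [∀ i, CompleteSpace (K i)]

/-- The Hilbert space direct sum of a family of representations. -/
def sumRep (π : ∀ i, A →⋆ₐ[ℂ] (K i →L[ℂ] K i)) : A →⋆ₐ[ℂ] (lp K 2 →L[ℂ] lp K 2) where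
  toFun a := lp.mapCLM 2 (fun i => π i a) (norm_nonneg a)
    fun i => NonUnitalStarAlgHom.norm_apply_le (π i) a
  map_one' := by ext x i; simp
  map_mul' a b := by ext x i; simp
  map_zero' := by ext x i; simp
  map_add' a b := by ext x i; simp
  commutes' r := by ext x i; simp [Algebra.algebraMap_eq_smul_one]
  map_star' a := by
    refine (ContinuousLinearMap.eq_adjoint_iff _ _).mpr fun x y => ?_
    rw [lp.inner_eq_tsum, lp.inner_eq_tsum]
    congr 1; ext i
    simp only [lp.mapCLM_apply_coe]
    rw [rep_inner_left, star_star]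

lemma sumRep_apply (π : ∀ i, A →⋆ₐ[ℂ] (K i →L[ℂ] K i)) (a : A) (x : lp K 2) (i : I) :
    sumRep π a x i = π i a (x i) := rfl

lemma exists_isometries_sumRep {H : Type*} [NormedAddCommGroup H] [InnerProductSpace ℂ H]
    (π : ∀ i, A →⋆ₐ[ℂ] (K i →L[ℂ] K i)) (i : I) (V₁ V₂ : H →ₗᵢ[ℂ] K i) :
    ∃ W₁ W₂ : H →ₗᵢ[ℂ] lp K 2,
      ∀ a x y, ⟪W₁ x, sumRep π a (W₂ y)⟫_ℂ = ⟪V₁ x, π i a (V₂ y)⟫_ℂ := by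
  classical
  let S : K i →ₗᵢ[ℂ] lp K 2 :=
    { lp.lsingle 2 i with
      norm_map' := fun x => lp.norm_single (by norm_num) i x }
  refine ⟨S.comp V₁, S.comp V₂, fun a x y => ?_⟩
  refine (lp.inner_single_left (𝕜 := ℂ) i (V₁ x) (sumRep π a (S (V₂ y)))).trans ?_
  rw [sumRep_apply]
  have e : (S (V₂ y)) i = V₂ y := lp.single_apply_self 2 i (V₂ y)
  rw [e]

end HilbertSum

section Universal

open scoped InnerProductSpace

variable (A : Type u) (H : Type v) [CStarAlgebra A] [PartialOrder A] [StarOrderedRing A]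
  [NormedAddCommGroup H] [InnerProductSpace ℂ H] [CompleteSpace H]

/-- A single representation through which all completely contractive maps factor. -/
theorem exists_universal_rep [Nontrivial A] :
    ∃ (K : Type (max u v)) (_ : NormedAddCommGroup K) (_ : InnerProductSpace ℂ K)
      (_ : CompleteSpace K) (π : A →⋆ₐ[ℂ] (K →L[ℂ] K)),
      ∀ ψ : A →ₗ[ℂ] (H →L[ℂ] H), cbENorm ψ ≤ 1 → ∃ V₁ V₂ : H →ₗᵢ[ℂ] K,
        ∀ a x y, ⟪x, ψ a y⟫_ℂ = ⟪V₁ x, π a (V₂ y)⟫_ℂ := by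
  choose K i1 i2 i3 π V₁ V₂ h using
    fun ψ : {ψ : A →ₗ[ℂ] (H →L[ℂ] H) // cbENorm ψ ≤ 1} => exists_isometries_of_cbENorm_le_one ψ.2
  refine ⟨lp K 2, inferInstance, inferInstance, inferInstance, sumRep π, fun ψ hψ => ?_⟩
  obtain ⟨W₁, W₂, hW⟩ := exists_isometries_sumRep π ⟨ψ, hψ⟩ (V₁ ⟨ψ, hψ⟩) (V₂ ⟨ψ, hψ⟩)
  exact ⟨W₁, W₂, fun a x y => (h ⟨ψ, hψ⟩ a x y).trans (hW a x y).symm⟩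

end Universal

section Model

open scoped InnerProductSpace
open ContinuousLinearMap (adjoint)

variable {A H K : Type*} [CStarAlgebra A]
  [NormedAddCommGroup H] [InnerProductSpace ℂ H]
  [NormedAddCommGroup K] [InnerProductSpace ℂ K] [CompleteSpace K]

/-- The isometric embedding of `K` as the first summand of `K ⊕ K ⊕ K`. -/
def firstEmb (K : Type*) [NormedAddCommGroup K] [InnerProductSpace ℂ K] :
    K →L[ℂ] WithLp 2 (K × WithLp 2 (K × K)) :=
  pairL (ContinuousLinearMap.id ℂ K) 0

/-- The operator `x ↦ (x, t x, 0)`. -/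
def skewEmb (K : Type*) [NormedAddCommGroup K] [InnerProductSpace ℂ K] (t : ℝ) :
    K →L[ℂ] WithLp 2 (K × WithLp 2 (K × K)) :=
  pairL (ContinuousLinearMap.id ℂ K) (pairL ((t : ℂ) • ContinuousLinearMap.id ℂ K) 0)

lemma adjoint_firstEmb_apply (x : WithLp 2 (K × WithLp 2 (K × K))) :
    adjoint (firstEmb K) x = x.fst := by
  refine ext_inner_left ℂ fun y => ?_
  rw [ContinuousLinearMap.adjoint_inner_right, WithLp.prod_inner_apply]
  change ⟪y, x.fst⟫_ℂ + ⟪(0 : WithLp 2 (K × K)), x.snd⟫_ℂ = _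
  simp

lemma adjoint_skewEmb_apply (t : ℝ) (x : WithLp 2 (K × WithLp 2 (K × K))) :
    adjoint (skewEmb K t) x = x.fst + (t : ℂ) • x.snd.fst := by
  refine ext_inner_left ℂ fun y => ?_
  rw [ContinuousLinearMap.adjoint_inner_right, WithLp.prod_inner_apply]
  change ⟪y, x.fst⟫_ℂ + ⟪(skewEmb K t y).snd, x.snd⟫_ℂ = _
  rw [WithLp.prod_inner_apply]
  change ⟪y, x.fst⟫_ℂ + (⟪(t : ℂ) • y, x.snd.fst⟫_ℂ + ⟪(0 : K), x.snd.snd⟫_ℂ) = _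
  rw [inner_add_right, inner_smul_left, inner_smul_right, Complex.conj_ofReal, inner_zero_left,
    add_zero]

/-- The homomorphism `a ↦ π(a) ⊗ E` on `K ⊕ K ⊕ K`, where `E` is the non-selfadjoint idempotent
`[1, t, 0; 0, 0, 0; 0, 0, 0]`. -/
def skewHom (π : A →⋆ₐ[ℂ] (K →L[ℂ] K)) (t : ℝ) :
    A →ₙₐ[ℂ] (WithLp 2 (K × WithLp 2 (K × K)) →L[ℂ] WithLp 2 (K × WithLp 2 (K × K))) where
  toFun a := firstEmb K ∘L π a ∘L adjoint (skewEmb K t)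
  map_smul' c a := by ext x; simp
  map_zero' := by ext x; simp
  map_add' a b := by ext x; simp
  map_mul' a b := by
    ext x
    change firstEmb K (π (a * b) (adjoint (skewEmb K t) x)) = firstEmb K (π a
      (adjoint (skewEmb K t) (firstEmb K (π b (adjoint (skewEmb K t) x)))))
    rw [adjoint_skewEmb_apply t (firstEmb K _), rep_mul_apply]
    congr 2
    change _ = π b (adjoint (skewEmb K t) x) + (t : ℂ) • (0 : K)
    simp

lemma skewHom_apply (π : A →⋆ₐ[ℂ] (K →L[ℂ] K)) (t : ℝ) (a : A)
    (x : WithLp 2 (K × WithLp 2 (K × K))) :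
    skewHom π t a x = firstEmb K (π a (adjoint (skewEmb K t) x)) := rfl

lemma star_skewHom_apply (π : A →⋆ₐ[ℂ] (K →L[ℂ] K)) (t : ℝ) (a : A)
    (x : WithLp 2 (K × WithLp 2 (K × K))) :
    star (skewHom π t a) x = skewEmb K t (π (star a) (adjoint (firstEmb K) x)) := by
  refine ext_inner_right ℂ fun y => ?_
  rw [ContinuousLinearMap.star_eq_adjoint, ContinuousLinearMap.adjoint_inner_left, skewHom_apply,
    ← ContinuousLinearMap.adjoint_inner_left (firstEmb K),
    ← ContinuousLinearMap.adjoint_inner_right (skewEmb K t), rep_inner_left, star_star]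

/-- The idempotent `E` satisfies `E⋆ E ⊗ π(u)⋆ π(u) = E⋆ E ⊗ 1`, and likewise for `E E⋆`. -/
lemma skewHom_regular (π : A →⋆ₐ[ℂ] (K →L[ℂ] K)) (t : ℝ) {u : A} (hu : u ∈ unitary A) :
    star (skewHom π t u) * skewHom π t u = star (skewHom π t 1) * skewHom π t 1 ∧
      skewHom π t u * star (skewHom π t u) = skewHom π t 1 * star (skewHom π t 1) := by
  have h1 (k : K) : adjoint (firstEmb K) (firstEmb K k) = k := by
    rw [adjoint_firstEmb_apply]; rfl
  have h2 (k : K) : adjoint (skewEmb K t) (skewEmb K t k) = k + (t : ℂ) • (t : ℂ) • k := by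
    rw [adjoint_skewEmb_apply]; rfl
  have key (u : A) (hu : u ∈ unitary A) :
      (∀ x, star (skewHom π t u) (skewHom π t u x) = skewEmb K t (adjoint (skewEmb K t) x)) ∧
      ∀ x, skewHom π t u (star (skewHom π t u) x)
        = firstEmb K (adjoint (firstEmb K) x + (t : ℂ) • (t : ℂ) • adjoint (firstEmb K) x) := by
    refine ⟨fun x => ?_, fun x => ?_⟩
    · rw [star_skewHom_apply, skewHom_apply, h1, ← rep_mul_apply, Unitary.star_mul_self_of_mem hu,
        map_one]
      rfl
    · rw [skewHom_apply, star_skewHom_apply, h2, map_add, map_smul, map_smul, ← rep_mul_apply,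
        Unitary.mul_star_self_of_mem hu, map_one]
      rfl
  constructor <;> ext1 x
  · exact ((key u hu).1 x).trans ((key 1 (one_mem _)).1 x).symm
  · exact ((key u hu).2 x).trans ((key 1 (one_mem _)).2 x).symm

/-- The compression of `skewHom π (17 / 6)` by an isometry can be any `V₁⋆ π(·) V₂` with isometries
`V₁`, `V₂`. -/
lemma exists_isometry_skewHom (π : A →⋆ₐ[ℂ] (K →L[ℂ] K)) (V₁ V₂ : H →ₗᵢ[ℂ] K) :
    ∃ V : H →L[ℂ] WithLp 2 (K × WithLp 2 (K × K)), Isometry V ∧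
      ∀ a x y, ⟪V x, skewHom π (17 / 6) a (V y)⟫_ℂ = ⟪V₁ x, π a (V₂ y)⟫_ℂ := by
  let L₁ : H →L[ℂ] K := V₁.toContinuousLinearMap
  let L₂ : H →L[ℂ] K := V₂.toContinuousLinearMap
  -- with `s = 3 / 5` and `t = 17 / 6`, the operators `s V₁`, `(s⁻¹ V₂ - s V₁) / t` and
  -- `(V₁ + V₂) / t` form an isometric column, since `s² + (s + s⁻¹)² / t² = 1`; the compression
  -- pairs the first of them with `s V₁ + (s⁻¹ V₂ - s V₁) = s⁻¹ V₂`
  let V : H →L[ℂ] WithLp 2 (K × WithLp 2 (K × K)) :=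
    pairL (((3 / 5 : ℝ) : ℂ) • L₁)
      (pairL (((10 / 17 : ℝ) : ℂ) • L₂ - ((18 / 85 : ℝ) : ℂ) • L₁) (((6 / 17 : ℝ) : ℂ) • (L₁ + L₂)))
  refine ⟨V, ?_, fun a x y => ?_⟩
  · refine AddMonoidHomClass.isometry_of_norm V fun x => ?_
    refine (sq_eq_sq₀ (norm_nonneg _) (norm_nonneg _)).mp ?_
    rw [norm_pairL_apply_sq, norm_pairL_apply_sq]
    have e1 : ‖L₁ x‖ = ‖x‖ := V₁.norm_map x
    have e2 : ‖L₂ x‖ = ‖x‖ := V₂.norm_map x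
    simp only [_root_.smul_apply, _root_.sub_apply, _root_.add_apply]
    rw [@norm_sub_sq ℂ, norm_smul, norm_smul, norm_smul, norm_smul, mul_pow _ ‖L₁ x + L₂ x‖,
      @norm_add_sq ℂ, e1, e2, inner_smul_left, inner_smul_right, ← inner_conj_symm (L₂ x) (L₁ x)]
    simp only [Complex.norm_real, Complex.conj_ofReal, RCLike.re_eq_complex_re,
      Complex.re_ofReal_mul, Complex.conj_re, Real.norm_eq_abs]
    rw [abs_of_pos (by norm_num), abs_of_pos (by norm_num), abs_of_pos (by norm_num),
      abs_of_pos (by norm_num)]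
    ring
  · rw [skewHom_apply, ← ContinuousLinearMap.adjoint_inner_left, adjoint_firstEmb_apply,
      adjoint_skewEmb_apply]
    change ⟪((3 / 5 : ℝ) : ℂ) • V₁ x, π a (((3 / 5 : ℝ) : ℂ) • V₁ y + ((17 / 6 : ℝ) : ℂ) •
      (((10 / 17 : ℝ) : ℂ) • V₂ y - ((18 / 85 : ℝ) : ℂ) • V₁ y))⟫_ℂ = _
    have e : ((3 / 5 : ℝ) : ℂ) • V₁ y + ((17 / 6 : ℝ) : ℂ) •
      (((10 / 17 : ℝ) : ℂ) • V₂ y - ((18 / 85 : ℝ) : ℂ) • V₁ y) = ((5 / 3 : ℝ) : ℂ) • V₂ y := by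
      push_cast
      module
    rw [e, map_smul, inner_smul_left, inner_smul_right, Complex.conj_ofReal, ← mul_assoc,
      ← Complex.ofReal_mul]
    norm_num

end Model

section

variable (A : Type u) (H : Type v) [CStarAlgebra A]
  [NormedAddCommGroup H] [InnerProductSpace ℂ H] [CompleteSpace H]

/-- Universal regular models exist. -/
theorem exists_universalRegularModel [PartialOrder A] [StarOrderedRing A] [Nontrivial A] :
    ∃ (K : Type (max u v)) (_ : NormedAddCommGroup K) (_ : InnerProductSpace ℂ K)
      (_ : CompleteSpace K) (τ : A →ₙₐ[ℂ] (K →L[ℂ] K)), IsUniversalRegularModel H τ := by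
  obtain ⟨K, _, _, _, π, h⟩ := exists_universal_rep A H
  refine ⟨WithLp 2 (K × WithLp 2 (K × K)), inferInstance, inferInstance, inferInstance,
    skewHom π (17 / 6), fun _ hu => skewHom_regular π _ hu, fun ψ hψ => ?_⟩
  obtain ⟨V₁, V₂, hV⟩ := h ψ hψ
  obtain ⟨V, hiso, hVτ⟩ := exists_isometry_skewHom π V₁ V₂
  exact ⟨V, hiso, implements_iff.mpr fun a x y => (hV a x y).trans (hVτ a x y).symm⟩

end

/-! ### The completely bounded norm -/

section CbNorm

variable {A : Type u} {H : Type v} [CStarAlgebra A] [PartialOrder A] [StarOrderedRing A]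
  [NormedAddCommGroup H] [InnerProductSpace ℂ H] [CompleteSpace H]

lemma cbENorm_smul_le (c : ℂ) (φ : A →ₗ[ℂ] (H →L[ℂ] H)) : cbENorm (c • φ) ≤ ‖c‖ₑ * cbENorm φ := by
  refine iSup_le fun k => iSup₂_le fun M hM => ?_
  have e : M.map (c • φ) = c • M.map φ := by ext; simp
  rw [e, enorm_smul]
  gcongr
  exact le_iSup_of_le k (le_iSup₂_of_le M hM le_rfl)

lemma eq_zero_of_cbENorm_eq_zero {φ : A →ₗ[ℂ] (H →L[ℂ] H)} (h : cbENorm φ = 0) : φ = 0 := by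
  ext1 a
  let M : CStarMatrix (Fin 1) (Fin 1) A := CStarMatrix.ofMatrix fun _ _ => a
  rcases eq_or_ne (‖M‖) 0 with h0 | h0
  · have : M 0 0 = 0 := by rw [norm_eq_zero.mp h0]; rfl
    change φ (M 0 0) = 0
    rw [this, map_zero]
  have hN : ‖((‖M‖ : ℂ)⁻¹) • M‖ ≤ 1 := by
    rw [norm_smul, norm_inv, Complex.norm_real, norm_norm, inv_mul_cancel₀ h0]
  have : ‖(((‖M‖ : ℂ)⁻¹) • M).map φ‖ₑ ≤ 0 :=
    (le_iSup_of_le 1 (le_iSup₂_of_le _ hN le_rfl) : _ ≤ cbENorm φ).trans_eq h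
  have h0' : (((‖M‖ : ℂ)⁻¹) • M).map φ = 0 := enorm_eq_zero.mp (nonpos_iff_eq_zero.mp this)
  have h1 : φ (((‖M‖ : ℂ)⁻¹) • a) = 0 := congrFun (congrFun h0' 0) 0
  rw [map_smul] at h1
  exact (smul_eq_zero.mp h1).resolve_left (inv_ne_zero (by exact_mod_cast h0))

lemma cbNorm_pos {φ : CB A H} (h : φ.1 ≠ 0) : 0 < cbNorm φ.1 :=
  ENNReal.toReal_pos (fun h0 => h (eq_zero_of_cbENorm_eq_zero h0)) φ.2.ne

/-- The normalization of a nonzero completely bounded map is completely contractive. -/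
lemma cbENorm_inv_smul_le_one {φ : CB A H} (h : φ.1 ≠ 0) :
    cbENorm ((cbNorm φ.1 : ℂ)⁻¹ • φ.1) ≤ 1 := by
  refine (cbENorm_smul_le _ _).trans (le_of_eq ?_)
  have hpos := cbNorm_pos h
  rw [← ofReal_norm, norm_inv, Complex.norm_real, Real.norm_of_nonneg hpos.le,
    ← ENNReal.ofReal_toReal φ.2.ne]
  change ENNReal.ofReal _ * ENNReal.ofReal (cbNorm φ.1) = 1
  rw [← ENNReal.ofReal_mul (inv_nonneg.mpr hpos.le), inv_mul_cancel₀ hpos.ne', ENNReal.ofReal_one]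

end CbNorm

/-! ### The regular coordinate -/

section RegGamma

variable {A : Type u} {H : Type v} {K : Type (max u v)} [CStarAlgebra A]
  [NormedAddCommGroup H] [InnerProductSpace ℂ H]
  [NormedAddCommGroup K] [InnerProductSpace ℂ K]

lemma cPlus_pos (τ : A →ₙₐ[ℂ] (K →L[ℂ] K)) : 0 < cPlus τ := by unfold cPlus; positivity

lemma regGamma_sub (τ : A →ₙₐ[ℂ] (K →L[ℂ] K)) (V W : H →L[ℂ] K) :
    regGamma τ V - regGamma τ W = regGamma τ (V - W) := by
  ext x
  change ((1 / √2 : ℝ) : ℂ) • WithLp.toLp 2 (V x, τ 1 (V x))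
    - ((1 / √2 : ℝ) : ℂ) • WithLp.toLp 2 (W x, τ 1 (W x))
    = ((1 / √2 : ℝ) : ℂ) • WithLp.toLp 2 (V x - W x, τ 1 (V x - W x))
  rw [map_sub, ← smul_sub]
  rfl

lemma norm_regGamma_apply_sq (τ : A →ₙₐ[ℂ] (K →L[ℂ] K)) (W : H →L[ℂ] K) (x : H) :
    ‖regGamma τ W x‖ ^ 2 = (‖W x‖ ^ 2 + ‖τ 1 (W x)‖ ^ 2) / 2 := by
  change ‖((1 / √2 : ℝ) : ℂ) • WithLp.toLp 2 (W x, τ 1 (W x))‖ ^ 2 = _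
  rw [norm_smul, mul_pow, Complex.norm_real, WithLp.prod_norm_sq_eq_of_L2, Real.norm_eq_abs, sq_abs,
    div_pow, one_pow, Real.sq_sqrt zero_le_two]
  change 1 / 2 * (‖W x‖ ^ 2 + ‖τ 1 (W x)‖ ^ 2) = _
  ring

lemma norm_regGamma_le (τ : A →ₙₐ[ℂ] (K →L[ℂ] K)) (W : H →L[ℂ] K) :
    ‖regGamma τ W‖ ≤ cPlus τ * ‖W‖ := by
  refine ContinuousLinearMap.opNorm_le_bound _ (mul_nonneg (cPlus_pos τ).le (norm_nonneg _))
    fun x => ?_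
  refine (sq_le_sq₀ (norm_nonneg _)
    (mul_nonneg (mul_nonneg (cPlus_pos τ).le (norm_nonneg _)) (norm_nonneg _))).mp ?_
  have hc : cPlus τ ^ 2 = (1 + ‖τ 1‖ ^ 2) / 2 := by
    rw [cPlus, div_pow, Real.sq_sqrt (by positivity), Real.sq_sqrt zero_le_two]
  have h1 : ‖W x‖ ^ 2 ≤ (‖W‖ * ‖x‖) ^ 2 := by gcongr; exact W.le_opNorm x
  have h2 : ‖τ 1 (W x)‖ ^ 2 ≤ (‖τ 1‖ * ‖W x‖) ^ 2 := by gcongr; exact (τ 1).le_opNorm _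
  rw [norm_regGamma_apply_sq, mul_assoc, mul_pow _ (‖W‖ * ‖x‖), hc]
  rw [mul_pow] at h2
  have h3 : ‖τ 1‖ ^ 2 * ‖W x‖ ^ 2 ≤ ‖τ 1‖ ^ 2 * (‖W‖ * ‖x‖) ^ 2 := by gcongr
  linarith

lemma norm_le_two_mul_norm_regGamma (τ : A →ₙₐ[ℂ] (K →L[ℂ] K)) (W : H →L[ℂ] K) :
    ‖W‖ ≤ 2 * ‖regGamma τ W‖ := by
  refine ContinuousLinearMap.opNorm_le_bound _ (by positivity) fun x => ?_
  rw [mul_assoc]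
  refine le_trans ?_ (mul_le_mul_of_nonneg_left ((regGamma τ W).le_opNorm x) zero_le_two)
  refine (sq_le_sq₀ (norm_nonneg _) (by positivity)).mp ?_
  rw [mul_pow, norm_regGamma_apply_sq]
  nlinarith [sq_nonneg (‖τ 1 (W x)‖), sq_nonneg ‖W x‖]

end RegGamma

section RegularCoordinate

variable {A : Type u} {H : Type v} [CStarAlgebra A] [PartialOrder A] [StarOrderedRing A]
  [NormedAddCommGroup H] [InnerProductSpace ℂ H] [CompleteSpace H]
  {K : Type (max u v)} [NormedAddCommGroup K] [InnerProductSpace ℂ K] [CompleteSpace K]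

lemma implements_of_mem_regImplementers {τ : A →ₙₐ[ℂ] (K →L[ℂ] K)} {φ : CB A H} {W : H →L[ℂ] K}
    (hW : W ∈ regImplementers τ φ) : Implements (fun a => τ a) W φ.1 := by
  rw [regImplementers] at hW
  split_ifs at hW with h
  · rw [Set.mem_singleton_iff] at hW
    subst hW
    exact implements_iff.mpr fun a x y => by simp [h]
  · obtain ⟨V, -, hV, rfl⟩ := hW
    have hpos := cbNorm_pos h
    refine implements_iff.mpr fun a x y => ?_
    have h1 := implements_iff.mp hV a x y
    change inner ℂ x ((cbNorm φ.1 : ℂ)⁻¹ • φ.1 a y) = _ at h1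
    change _ = inner ℂ (((√(cbNorm φ.1) : ℝ) : ℂ) • V x) (τ a (((√(cbNorm φ.1) : ℝ) : ℂ) • V y))
    rw [inner_smul_right] at h1
    rw [map_smul, inner_smul_left, inner_smul_right, ← h1, Complex.conj_ofReal, ← mul_assoc,
      ← mul_assoc, ← Complex.ofReal_mul, Real.mul_self_sqrt hpos.le, mul_inv_cancel₀, one_mul]
    exact_mod_cast hpos.ne'

lemma norm_le_of_mem_regImplementers {τ : A →ₙₐ[ℂ] (K →L[ℂ] K)} {φ : CB A H} {W : H →L[ℂ] K}
    (hW : W ∈ regImplementers τ φ) : ‖W‖ ≤ √(cbNorm φ.1) := by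
  rw [regImplementers] at hW
  split_ifs at hW with h
  · rw [Set.mem_singleton_iff] at hW
    subst hW
    simp
  · obtain ⟨V, hV, -, rfl⟩ := hW
    refine ContinuousLinearMap.opNorm_le_bound _ (Real.sqrt_nonneg _) fun x => ?_
    change ‖((√(cbNorm φ.1) : ℝ) : ℂ) • V x‖ ≤ _
    rw [norm_smul, Complex.norm_real, Real.norm_of_nonneg (Real.sqrt_nonneg _),
      (AddMonoidHomClass.isometry_iff_norm V).mp hV x]

lemma regImplementers_nonempty {τ : A →ₙₐ[ℂ] (K →L[ℂ] K)} (hτ : IsUniversalRegularModel H τ)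
    (φ : CB A H) : (regImplementers τ φ).Nonempty := by
  rw [regImplementers]
  split_ifs with h
  · exact Set.singleton_nonempty _
  · obtain ⟨V, hV, hV'⟩ := hτ.2 _ (cbENorm_inv_smul_le_one h)
    exact ⟨_, V, hV, hV', rfl⟩

lemma regEDist_self (φ : CB A H) : regEDist φ φ = 0 := by
  simp [regEDist]

lemma regEDist_comm (φ ψ : CB A H) : regEDist φ ψ = regEDist ψ φ := by
  simp only [regEDist, Metric.hausdorffEDist_comm]

lemma hausdorffEDist_div_le_regEDist {τ : A →ₙₐ[ℂ] (K →L[ℂ] K)} (hτ : IsUniversalRegularModel H τ)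
    (φ ψ : CB A H) :
    Metric.hausdorffEDist (regSet τ φ) (regSet τ ψ) / ENNReal.ofReal (cPlus τ) ≤ regEDist φ ψ :=
  le_iSup_of_le K <| le_iSup_of_le _ <| le_iSup_of_le _ <| le_iSup_of_le _ <|
    le_iSup₂_of_le τ hτ le_rfl

lemma regEDist_le {c : ℝ≥0∞} {φ ψ : CB A H}
    (h : ∀ (K : Type (max u v)) (_ : NormedAddCommGroup K) (_ : InnerProductSpace ℂ K)
      (_ : CompleteSpace K) (τ : A →ₙₐ[ℂ] (K →L[ℂ] K)), IsUniversalRegularModel H τ →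
      Metric.hausdorffEDist (regSet τ φ) (regSet τ ψ) / ENNReal.ofReal (cPlus τ) ≤ c) :
    regEDist φ ψ ≤ c :=
  iSup_le fun K => iSup_le fun i1 => iSup_le fun i2 => iSup_le fun i3 => iSup₂_le fun τ hτ =>
    h K i1 i2 i3 τ hτ

lemma regEDist_triangle (φ ψ χ : CB A H) : regEDist φ χ ≤ regEDist φ ψ + regEDist ψ χ := by
  refine regEDist_le fun K _ _ _ τ hτ => ?_
  refine le_trans ?_ (add_le_add (hausdorffEDist_div_le_regEDist hτ φ ψ)
    (hausdorffEDist_div_le_regEDist hτ ψ χ))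
  rw [← ENNReal.add_div]
  gcongr
  exact Metric.hausdorffEDist_triangle

lemma regEDist_le_ofReal (φ ψ : CB A H) :
    regEDist φ ψ ≤ ENNReal.ofReal (√(cbNorm φ.1) + √(cbNorm ψ.1)) := by
  refine regEDist_le fun K _ _ _ τ hτ => ENNReal.div_le_of_le_mul ?_
  have key {φ ψ : CB A H} {V W : H →L[ℂ] K} (hV : V ∈ regImplementers τ φ)
      (hW : W ∈ regImplementers τ ψ) : edist (regGamma τ V) (regGamma τ W)
        ≤ ENNReal.ofReal (√(cbNorm φ.1) + √(cbNorm ψ.1)) * ENNReal.ofReal (cPlus τ) := by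
    rw [edist_eq_enorm_sub, regGamma_sub, ← ofReal_norm,
      ← ENNReal.ofReal_mul (by positivity)]
    refine ENNReal.ofReal_le_ofReal ((norm_regGamma_le _ _).trans ?_)
    rw [mul_comm]
    refine mul_le_mul_of_nonneg_right ((norm_sub_le _ _).trans ?_) (cPlus_pos τ).le
    exact add_le_add (norm_le_of_mem_regImplementers hV) (norm_le_of_mem_regImplementers hW)
  obtain ⟨V₀, hV₀⟩ := regImplementers_nonempty hτ φ
  obtain ⟨W₀, hW₀⟩ := regImplementers_nonempty hτ ψ
  refine Metric.hausdorffEDist_le_of_mem_edist ?_ ?_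
  · rintro _ ⟨V, hV, rfl⟩
    exact ⟨_, ⟨W₀, hW₀, rfl⟩, key hV hW₀⟩
  · rintro _ ⟨W, hW, rfl⟩
    exact ⟨_, ⟨V₀, hV₀, rfl⟩, (key hW hV₀).trans_eq (by rw [add_comm])⟩

lemma regEDist_zeroCB_le (φ : CB A H) : regEDist φ zeroCB ≤ ENNReal.ofReal √(cbNorm φ.1) := by
  refine (regEDist_le_ofReal φ zeroCB).trans_eq ?_
  have h : cbENorm (0 : A →ₗ[ℂ] (H →L[ℂ] H)) = 0 := by
    simpa using cbENorm_smul_le (0 : ℂ) (0 : A →ₗ[ℂ] (H →L[ℂ] H))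
  have h0 : cbNorm (zeroCB : CB A H).1 = 0 := by
    rw [cbNorm]
    exact (congrArg ENNReal.toReal h).trans ENNReal.toReal_zero
  rw [h0, Real.sqrt_zero, add_zero]

lemma regEDist_ne_top (φ ψ : CB A H) : regEDist φ ψ ≠ ⊤ :=
  ne_top_of_le_ne_top ENNReal.ofReal_ne_top (regEDist_le_ofReal φ ψ)

/-- Since a universal regular model exists, the regular coordinate separates the points: `Γ_τ` is
bounded below, and the implemented map depends continuously on the implementing operator. -/
lemma eq_of_regEDist_eq_zero {φ ψ : CB A H} (h : regEDist φ ψ = 0) : φ = ψ := by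
  rcases subsingleton_or_nontrivial A with hA | hA
  · ext1; ext1 a
    rw [Subsingleton.elim a 0, map_zero, map_zero]
  obtain ⟨K, _, _, _, τ, hτ⟩ := exists_universalRegularModel A H
  have hd : Metric.hausdorffEDist (regSet τ φ) (regSet τ ψ) = 0 := by
    have := nonpos_iff_eq_zero.mp ((hausdorffEDist_div_le_regEDist hτ φ ψ).trans_eq h)
    exact (ENNReal.div_eq_zero_iff.mp this).resolve_right ENNReal.ofReal_ne_top
  obtain ⟨V, hV⟩ := regImplementers_nonempty hτ φ
  ext1; ext1 a
  rw [← sub_eq_zero, ← norm_le_zero_iff]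
  refine le_of_forall_pos_lt_add fun ε hε => ?_
  set C : ℝ := (√(cbNorm φ.1) + √(cbNorm ψ.1)) * ‖τ a‖ * 2
  have hC : 0 ≤ C := by positivity
  obtain ⟨_, ⟨W, hW, rfl⟩, hVW⟩ := Metric.exists_edist_lt_of_hausdorffEDist_lt
    (r := ENNReal.ofReal (ε / (C + 1))) (Set.mem_image_of_mem (regGamma τ) hV)
    (hd.trans_lt (ENNReal.ofReal_pos.mpr (by positivity)))
  rw [edist_eq_enorm_sub, regGamma_sub, ← ofReal_norm,
    ENNReal.ofReal_lt_ofReal_iff (by positivity)] at hVW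
  calc ‖φ.1 a - ψ.1 a‖ ≤ (‖V‖ + ‖W‖) * ‖τ a‖ * ‖V - W‖ :=
        norm_sub_le_of_implements (implements_of_mem_regImplementers hV)
          (implements_of_mem_regImplementers hW) a
    _ ≤ (√(cbNorm φ.1) + √(cbNorm ψ.1)) * ‖τ a‖ * (2 * ‖regGamma τ (V - W)‖) := by
        gcongr
        · exact norm_le_of_mem_regImplementers hV
        · exact norm_le_of_mem_regImplementers hW
        · exact norm_le_two_mul_norm_regGamma τ _
    _ = C * ‖regGamma τ (V - W)‖ := by simp only [C]; ring
    _ ≤ C * (ε / (C + 1)) := by gcongr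
    _ < 0 + ε := by
        rw [zero_add, mul_div_assoc', div_lt_iff₀ (by positivity)]
        linarith

end RegularCoordinate

/-! ### The `ℓ^p` norm of a pair -/

section LpPair

variable {p : ℝ≥0∞}

lemma lpPair_mono {a b a' b' : ℝ≥0∞} (ha : a ≤ a') (hb : b ≤ b') :
    lpPair p a b ≤ lpPair p a' b' := by
  unfold lpPair
  split_ifs
  · exact max_le_max ha hb
  · gcongr

lemma lpPair_add_le (hp : 1 ≤ p) (a b a' b' : ℝ≥0∞) :
    lpPair p (a + a') (b + b') ≤ lpPair p a b + lpPair p a' b' := by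
  unfold lpPair
  split_ifs with h
  · exact max_le (add_le_add (le_max_left _ _) (le_max_left _ _))
      (add_le_add (le_max_right _ _) (le_max_right _ _))
  · simpa [Fin.sum_univ_two] using
      ENNReal.Lp_add_le Finset.univ ![a, b] ![a', b'] (ENNReal.toReal_mono h hp)

lemma toReal_pos_of_one_le (hp : 1 ≤ p) (h : p ≠ ⊤) : 0 < p.toReal :=
  zero_lt_one.trans_le (ENNReal.toReal_mono h hp)

lemma lpPair_zero_right (hp : 1 ≤ p) (a : ℝ≥0∞) : lpPair p a 0 = a := by
  unfold lpPair
  split_ifs with h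
  · simp
  · have := toReal_pos_of_one_le hp h
    rw [ENNReal.zero_rpow_of_pos this, add_zero, one_div, ENNReal.rpow_rpow_inv this.ne']

lemma lpPair_zero_left (hp : 1 ≤ p) (b : ℝ≥0∞) : lpPair p 0 b = b := by
  unfold lpPair
  split_ifs with h
  · simp
  · have := toReal_pos_of_one_le hp h
    rw [ENNReal.zero_rpow_of_pos this, zero_add, one_div, ENNReal.rpow_rpow_inv this.ne']

lemma le_lpPair_left (hp : 1 ≤ p) (a b : ℝ≥0∞) : a ≤ lpPair p a b :=
  (lpPair_zero_right hp a).ge.trans (lpPair_mono le_rfl zero_le)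

lemma le_lpPair_right (hp : 1 ≤ p) (a b : ℝ≥0∞) : b ≤ lpPair p a b :=
  (lpPair_zero_left hp b).ge.trans (lpPair_mono zero_le le_rfl)

lemma lpPair_le_add (hp : 1 ≤ p) (a b : ℝ≥0∞) : lpPair p a b ≤ a + b := by
  simpa [lpPair_zero_left hp, lpPair_zero_right hp] using lpPair_add_le hp a 0 0 b

end LpPair

/-! ### The Bures–Kuratowski distance -/

section BuresKuratowskiDistance

variable {A : Type u} {H : Type v} [CStarAlgebra A] [PartialOrder A] [StarOrderedRing A]
  [NormedAddCommGroup H] [InnerProductSpace ℂ H] [CompleteSpace H]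

lemma zeroCB_mem_CPCone : (zeroCB : CB A H) ∈ CPCone A H :=
  ⟨{ toLinearMap := 0
     map_cstarMatrix_nonneg' := fun k M _ => le_of_eq (by ext; simp) }, rfl⟩

/-- The cone of completely positive maps is salient. -/
lemma eq_zero_of_mem_CPCone_of_neg_mem {φ ψ : CB A H} (hφ : φ ∈ CPCone A H) (hψ : ψ ∈ CPCone A H)
    (h : ψ.1 = -φ.1) : φ.1 = 0 := by
  obtain ⟨f, hf⟩ := hφ
  obtain ⟨g, hg⟩ := hψ
  have hpos (a : A) (ha : 0 ≤ a) : φ.1 a = 0 := by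
    refine le_antisymm ?_ ?_
    · have h1 : 0 ≤ ψ.1 a := hg ▸ (map_nonneg g ha : 0 ≤ g a)
      rw [h] at h1
      exact neg_nonneg.mp h1
    · exact hf ▸ (map_nonneg f ha : 0 ≤ f a)
  refine LinearMap.ext_on (CStarAlgebra.span_nonneg (A := A)) fun a ha => ?_
  exact hpos a ha

lemma ofReal_buresDist (θ₁ θ₂ : CPCone A H) :
    ENNReal.ofReal (buresDist θ₁.1.1 θ₂.1.1) = buresEDist θ₁.1.1 θ₂.1.1 := by
  obtain ⟨f, hf⟩ := θ₁.2
  obtain ⟨g, hg⟩ := θ₂.2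
  rw [← hf, ← hg]
  exact ENNReal.ofReal_toReal (buresEDist_ne_top f g)

lemma buresEDist_cone_ne_top (θ₁ θ₂ : CPCone A H) : buresEDist θ₁.1.1 θ₂.1.1 ≠ ⊤ := by
  rw [← ofReal_buresDist]; exact ENNReal.ofReal_ne_top

lemma buresEDist_cone_self (θ : CPCone A H) : buresEDist θ.1.1 θ.1.1 = 0 := by
  obtain ⟨f, hf⟩ := θ.2
  rw [← hf]
  exact buresEDist_self f

/-- A finite extended metric is a metric. -/
lemma isMetric_toReal {X : Type*} {d : X → X → ℝ≥0∞} (hfin : ∀ x y, d x y ≠ ⊤)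
    (hself : ∀ x, d x x = 0) (heq : ∀ x y, d x y = 0 → x = y) (hsymm : ∀ x y, d x y = d y x)
    (htri : ∀ x y z, d x z ≤ d x y + d y z) : IsMetric fun x y => (d x y).toReal where
  nonneg _ _ := ENNReal.toReal_nonneg
  eq_zero_iff x y := by
    rw [ENNReal.toReal_eq_zero_iff, or_iff_left (hfin x y)]
    exact ⟨heq x y, fun h => h ▸ hself x⟩
  symm x y := by rw [hsymm]
  triangle x y z := by
    rw [← ENNReal.toReal_add (hfin _ _) (hfin _ _)]
    exact ENNReal.toReal_mono (ENNReal.add_ne_top.mpr ⟨hfin _ _, hfin _ _⟩) (htri x y z)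

variable (A H) in
lemma isMetric_buresDist : IsMetric fun θ₁ θ₂ : CPCone A H => buresDist θ₁.1.1 θ₂.1.1 :=
  isMetric_toReal buresEDist_cone_ne_top buresEDist_cone_self
    (fun _ _ h => Subtype.ext (Subtype.ext (eq_of_buresEDist_eq_zero h)))
    (fun _ _ => buresEDist_comm _ _) fun _ _ _ => buresEDist_triangle _ _ _

open Classical in
/-- The retraction of `CB(A, B(H))` onto the completely positive cone which is constantly `θ` off
the cone. -/
def coneRetract (θ : CPCone A H) (φ : CB A H) : CPCone A H :=
  if h : φ ∈ CPCone A H then ⟨φ, h⟩ else θ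

lemma coneRetract_of_mem (θ : CPCone A H) {φ : CB A H} (h : φ ∈ CPCone A H) :
    coneRetract θ φ = ⟨φ, h⟩ := dif_pos h

lemma coneRetract_of_notMem (θ : CPCone A H) {φ : CB A H} (h : φ ∉ CPCone A H) :
    coneRetract θ φ = θ := dif_neg h

open Classical in
/-- The map sending the completely positive cone to `0` and fixing every other map. -/
def coneCollapse (φ : CB A H) : CB A H := if φ ∈ CPCone A H then zeroCB else φ

/-- The Kuratowski coordinate is the Bures distance after retracting onto the cone. -/
lemma kuratowskiEDist_eq (θ : CPCone A H) (φ ψ : CB A H) :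
    kuratowskiEDist θ φ ψ = buresEDist (coneRetract θ φ).1.1 (coneRetract θ ψ).1.1 := by
  have hk (φ : CB A H) (η : CPCone A H) : kuratowski θ φ η
      = buresDist (coneRetract θ φ).1.1 η.1.1 - buresDist θ.1.1 η.1.1 := by
    by_cases h : φ ∈ CPCone A H
    · rw [coneRetract_of_mem θ h, kuratowski, if_pos h]
    · rw [coneRetract_of_notMem θ h, kuratowski, if_neg h, sub_self]
  have hB := isMetric_buresDist A H
  rw [← ofReal_buresDist]
  refine le_antisymm (iSup_le fun η => ?_) (le_iSup_of_le (coneRetract θ ψ) ?_)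
  · rw [hk, hk, sub_sub_sub_cancel_right, ← ofReal_norm]
    refine ENNReal.ofReal_le_ofReal (abs_sub_le_iff.mpr ⟨?_, ?_⟩)
    · have := hB.triangle (coneRetract θ φ) (coneRetract θ ψ) η
      linarith
    · have := hB.triangle (coneRetract θ ψ) (coneRetract θ φ) η
      rw [hB.symm (coneRetract θ ψ) (coneRetract θ φ)] at this
      linarith
  · rw [hk, hk, sub_sub_sub_cancel_right, (hB.eq_zero_iff (coneRetract θ ψ) _).mpr rfl, sub_zero,
      ← ofReal_norm]
    exact ENNReal.ofReal_le_ofReal (le_abs_self _)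

lemma collapsedRegEDist_eq (φ ψ : CB A H) :
    collapsedRegEDist φ ψ = regEDist (coneCollapse φ) (coneCollapse ψ) := by
  unfold collapsedRegEDist coneCollapse regRadius
  split_ifs
  · exact (regEDist_self _).symm
  · exact regEDist_comm _ _
  · rfl
  · rfl

lemma eq_of_coneRetract_eq_of_coneCollapse_eq {θ : CPCone A H} {φ ψ : CB A H}
    (h₁ : coneRetract θ φ = coneRetract θ ψ) (h₂ : coneCollapse φ = coneCollapse ψ) : φ = ψ := by
  by_cases hφ : φ ∈ CPCone A H <;> by_cases hψ : ψ ∈ CPCone A H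
  · rw [coneRetract_of_mem θ hφ, coneRetract_of_mem θ hψ] at h₁
    exact congrArg Subtype.val h₁
  · rw [coneCollapse, coneCollapse, if_pos hφ, if_neg hψ] at h₂
    exact absurd (h₂ ▸ zeroCB_mem_CPCone) hψ
  · rw [coneCollapse, coneCollapse, if_neg hφ, if_pos hψ] at h₂
    exact absurd (h₂ ▸ zeroCB_mem_CPCone) hφ
  · rwa [coneCollapse, coneCollapse, if_neg hφ, if_neg hψ] at h₂

variable {lam : ℝ} {p : ℝ≥0∞} {alpha : ℝ}

lemma bkEDist_eq (θ : CPCone A H) (φ ψ : CB A H) :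
    bkEDist lam p alpha θ φ ψ =
      lpPair p (buresEDist (coneRetract θ φ).1.1 (coneRetract θ ψ).1.1)
        (ENNReal.ofReal lam * regEDist (coneCollapse φ) (coneCollapse ψ) ^ alpha) := by
  rw [bkEDist, kuratowskiEDist_eq, collapsedRegEDist_eq]

lemma bkEDist_ne_top (hp : 1 ≤ p) (halpha : 0 ≤ alpha) (θ : CPCone A H) (φ ψ : CB A H) :
    bkEDist lam p alpha θ φ ψ ≠ ⊤ := by
  rw [bkEDist_eq]
  refine ne_top_of_le_ne_top (ENNReal.add_ne_top.mpr ⟨buresEDist_cone_ne_top _ _, ?_⟩)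
    (lpPair_le_add hp _ _)
  exact ENNReal.mul_ne_top ENNReal.ofReal_ne_top
    (ENNReal.rpow_ne_top_of_nonneg halpha (regEDist_ne_top _ _))

lemma isMetric_bkDist (hlam : 0 < lam) (hp : 1 ≤ p) (halpha : alpha ∈ Set.Ioc (0 : ℝ) 1)
    (θ : CPCone A H) : IsMetric (bkDist lam p alpha θ) := by
  refine isMetric_toReal (bkEDist_ne_top hp halpha.1.le θ) (fun φ => ?_) (fun φ ψ h => ?_)
    (fun φ ψ => ?_) fun φ ψ χ => ?_
  · rw [bkEDist_eq, buresEDist_cone_self, regEDist_self, ENNReal.zero_rpow_of_pos halpha.1,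
      mul_zero, lpPair_zero_right hp]
  · rw [bkEDist_eq] at h
    have h₁ := nonpos_iff_eq_zero.mp ((le_lpPair_left hp _ _).trans_eq h)
    have h₂ := nonpos_iff_eq_zero.mp ((le_lpPair_right hp _ _).trans_eq h)
    refine eq_of_coneRetract_eq_of_coneCollapse_eq (θ := θ)
      (Subtype.ext (Subtype.ext (eq_of_buresEDist_eq_zero h₁))) (eq_of_regEDist_eq_zero ?_)
    rcases mul_eq_zero.mp h₂ with h₃ | h₃
    · exact absurd (ENNReal.ofReal_eq_zero.mp h₃) hlam.not_ge
    · exact (ENNReal.rpow_eq_zero_iff_of_pos halpha.1).mp h₃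
  · simp only [bkEDist_eq, buresEDist_comm (coneRetract θ φ).1.1, regEDist_comm (coneCollapse φ)]
  · simp only [bkEDist_eq]
    refine (lpPair_mono (buresEDist_triangle _ (coneRetract θ ψ).1.1 _) ?_).trans
      (lpPair_add_le hp _ _ _ _)
    rw [← mul_add]
    gcongr
    exact (ENNReal.rpow_le_rpow (regEDist_triangle _ (coneCollapse ψ) _) halpha.1.le).trans
      (ENNReal.rpow_add_le_add_rpow _ _ halpha.1.le halpha.2)

/-- Moving the anchor changes the Bures–Kuratowski distance by at most the displacement of the
anchor: only the coordinate of a pair with exactly one member in the cone is affected. -/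
lemma bkEDist_le_add (hp : 1 ≤ p) (θ₁ θ₂ : CPCone A H) (φ ψ : CB A H) :
    bkEDist lam p alpha θ₁ φ ψ ≤ bkEDist lam p alpha θ₂ φ ψ + buresEDist θ₁.1.1 θ₂.1.1 := by
  simp only [bkEDist_eq]
  set c := ENNReal.ofReal lam * regEDist (coneCollapse φ) (coneCollapse ψ) ^ alpha
  rw [← lpPair_zero_right hp (buresEDist θ₁.1.1 θ₂.1.1)]
  refine (lpPair_mono ?_ (add_zero c).ge).trans (lpPair_add_le hp _ _ _ _)
  by_cases hφ : φ ∈ CPCone A H <;> by_cases hψ : ψ ∈ CPCone A H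
  · simp only [coneRetract_of_mem _ hφ, coneRetract_of_mem _ hψ]
    exact le_self_add
  · simp only [coneRetract_of_mem _ hφ, coneRetract_of_notMem _ hψ]
    rw [buresEDist_comm θ₁.1.1]
    exact buresEDist_triangle _ _ _
  · simp only [coneRetract_of_notMem _ hφ, coneRetract_of_mem _ hψ]
    rw [add_comm]
    exact buresEDist_triangle _ _ _
  · simp only [coneRetract_of_notMem _ hφ, coneRetract_of_notMem _ hψ]
    rw [buresEDist_cone_self]
    exact zero_le

/-- If there is a nonzero completely bounded map, then there are maps off the completely positive
cone that are arbitrarily close to `0` in the regular coordinate: of `t φ` and `-t φ`, at least one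
is not completely positive. -/
lemma exists_notMem_CPCone_regEDist_le {φ : CB A H} (hφ : φ.1 ≠ 0) {ε : ℝ} (hε : 0 < ε) :
    ∃ ψ : CB A H, ψ ∉ CPCone A H ∧ regEDist zeroCB ψ ≤ ENNReal.ofReal ε := by
  have hpos := cbNorm_pos hφ
  set t : ℝ := ε ^ 2 / cbNorm φ.1
  have ht : 0 < t := by positivity
  have hcb (s : ℂ) (hs : ‖s‖ = t) : cbENorm (s • φ.1) ≤ ENNReal.ofReal (ε ^ 2) := by
    refine (cbENorm_smul_le _ _).trans (le_of_eq ?_)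
    rw [← ofReal_norm, hs, ← ENNReal.ofReal_toReal φ.2.ne,
      ← ENNReal.ofReal_mul ht.le]
    exact congrArg _ (div_mul_cancel₀ _ hpos.ne')
  have hr (ψ : CB A H) (h : cbENorm ψ.1 ≤ ENNReal.ofReal (ε ^ 2)) :
      regEDist zeroCB ψ ≤ ENNReal.ofReal ε := by
    rw [regEDist_comm]
    refine (regEDist_zeroCB_le ψ).trans (ENNReal.ofReal_le_ofReal ?_)
    exact Real.sqrt_le_iff.mpr ⟨hε.le, ENNReal.toReal_le_of_le_ofReal (sq_nonneg ε) h⟩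
  have n1 : ‖(t : ℂ)‖ = t := by rw [Complex.norm_real, Real.norm_of_nonneg ht.le]
  have n2 : ‖-(t : ℂ)‖ = t := by rw [norm_neg, n1]
  let ψ₁ : CB A H := ⟨(t : ℂ) • φ.1, (hcb _ n1).trans_lt ENNReal.ofReal_lt_top⟩
  let ψ₂ : CB A H := ⟨-(t : ℂ) • φ.1, (hcb _ n2).trans_lt ENNReal.ofReal_lt_top⟩
  by_cases h₁ : ψ₁ ∈ CPCone A H
  · refine ⟨ψ₂, fun h₂ => ?_, hr _ (hcb _ n2)⟩
    have : (t : ℂ) • φ.1 = 0 := eq_zero_of_mem_CPCone_of_neg_mem h₁ h₂ (neg_smul (t : ℂ) φ.1)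
    exact (smul_ne_zero (by exact_mod_cast ht.ne') hφ) this
  · exact ⟨ψ₁, h₁, hr _ (hcb _ n1)⟩

/-- The displacement of the anchor is attained in the limit on the pairs `(θ₁, ψ)`, where `ψ` is off
the cone and tends to `0`. -/
lemma buresEDist_le_uniformDist (hp : 1 ≤ p) (halpha : alpha ∈ Set.Ioc (0 : ℝ) 1)
    (hmet : ∀ θ : CPCone A H, IsMetric (bkDist lam p alpha θ)) (θ₁ θ₂ : CPCone A H) :
    buresEDist θ₁.1.1 θ₂.1.1
      ≤ uniformDist (⟨bkDist lam p alpha θ₁, hmet θ₁⟩ : Met (CB A H)) ⟨_, hmet θ₂⟩ := by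
  -- if `0` is the only completely bounded map, then the anchors agree
  by_cases hX : ∀ φ : CB A H, φ.1 = 0
  · rw [hX θ₁, ← hX θ₂, buresEDist_cone_self]
    exact zero_le
  push Not at hX
  obtain ⟨φ, hφ⟩ := hX
  have hlim : Filter.Tendsto (fun ε : ℝ => uniformDist
      (⟨bkDist lam p alpha θ₁, hmet θ₁⟩ : Met (CB A H)) ⟨_, hmet θ₂⟩
        + ENNReal.ofReal lam * ENNReal.ofReal ε ^ alpha) (nhdsWithin 0 (Set.Ioi 0))
      (nhds (uniformDist (⟨bkDist lam p alpha θ₁, hmet θ₁⟩ : Met (CB A H)) ⟨_, hmet θ₂⟩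
        + ENNReal.ofReal lam * ENNReal.ofReal 0 ^ alpha)) := by
    refine Filter.Tendsto.mono_left ?_ nhdsWithin_le_nhds
    refine Filter.Tendsto.add tendsto_const_nhds (ENNReal.Tendsto.const_mul ?_
      (Or.inr ENNReal.ofReal_ne_top))
    exact (ENNReal.continuous_rpow_const.comp ENNReal.continuous_ofReal).tendsto 0
  rw [ENNReal.ofReal_zero, ENNReal.zero_rpow_of_pos halpha.1, mul_zero, add_zero] at hlim
  refine ge_of_tendsto hlim (Filter.eventually_of_mem self_mem_nhdsWithin fun ε hε => ?_)
  obtain ⟨ψ, hψ, hle⟩ := exists_notMem_CPCone_regEDist_le hφ (Set.mem_Ioi.mp hε)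
  have hc : coneCollapse θ₁.1 = (zeroCB : CB A H) := if_pos θ₁.2
  have hcψ : coneCollapse ψ = ψ := if_neg hψ
  have h₁ : bkEDist lam p alpha θ₁ θ₁.1 ψ ≤ ENNReal.ofReal lam * ENNReal.ofReal ε ^ alpha := by
    rw [bkEDist_eq, coneRetract_of_mem θ₁ θ₁.2, coneRetract_of_notMem θ₁ hψ, hc, hcψ,
      buresEDist_cone_self θ₁, lpPair_zero_left hp]
    gcongr
    exact halpha.1.le
  have h₂ : buresEDist θ₁.1.1 θ₂.1.1 ≤ bkEDist lam p alpha θ₂ θ₁.1 ψ := by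
    rw [bkEDist_eq, coneRetract_of_mem θ₂ θ₁.2, coneRetract_of_notMem θ₂ hψ]
    exact le_lpPair_left hp _ _
  have hfin (θ : CPCone A H) : ENNReal.ofReal (bkDist lam p alpha θ θ₁.1 ψ)
      = bkEDist lam p alpha θ θ₁.1 ψ :=
    ENNReal.ofReal_toReal (bkEDist_ne_top hp halpha.1.le θ _ _)
  have hD : ENNReal.ofReal |bkDist lam p alpha θ₁ θ₁.1 ψ - bkDist lam p alpha θ₂ θ₁.1 ψ|
      ≤ uniformDist (⟨bkDist lam p alpha θ₁, hmet θ₁⟩ : Met (CB A H)) ⟨_, hmet θ₂⟩ :=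
    le_iSup₂_of_le θ₁.1 ψ le_rfl
  calc buresEDist θ₁.1.1 θ₂.1.1 ≤ ENNReal.ofReal (bkDist lam p alpha θ₂ θ₁.1 ψ) :=
        h₂.trans_eq (hfin θ₂).symm
    _ ≤ ENNReal.ofReal (|bkDist lam p alpha θ₁ θ₁.1 ψ - bkDist lam p alpha θ₂ θ₁.1 ψ|
          + bkDist lam p alpha θ₁ θ₁.1 ψ) := by
        refine ENNReal.ofReal_le_ofReal ?_
        rw [abs_sub_comm]
        linarith [le_abs_self (bkDist lam p alpha θ₂ θ₁.1 ψ - bkDist lam p alpha θ₁ θ₁.1 ψ)]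
    _ = ENNReal.ofReal |bkDist lam p alpha θ₁ θ₁.1 ψ - bkDist lam p alpha θ₂ θ₁.1 ψ|
          + bkEDist lam p alpha θ₁ θ₁.1 ψ := by
        rw [ENNReal.ofReal_add (abs_nonneg _) ((hmet θ₁).nonneg _ _), hfin]
    _ ≤ _ := add_le_add hD h₁

theorem uniformDist_bkDist (hp : 1 ≤ p) (halpha : alpha ∈ Set.Ioc (0 : ℝ) 1)
    (hmet : ∀ θ : CPCone A H, IsMetric (bkDist lam p alpha θ)) (θ₁ θ₂ : CPCone A H) :
    uniformDist (⟨bkDist lam p alpha θ₁, hmet θ₁⟩ : Met (CB A H)) ⟨_, hmet θ₂⟩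
      = ENNReal.ofReal (buresDist θ₁.1.1 θ₂.1.1) := by
  refine le_antisymm (iSup₂_le fun φ ψ => ENNReal.ofReal_le_ofReal ?_)
    ((ofReal_buresDist θ₁ θ₂).trans_le (buresEDist_le_uniformDist hp halpha hmet θ₁ θ₂))
  have key (θ₁ θ₂ : CPCone A H) : bkDist lam p alpha θ₁ φ ψ
      ≤ bkDist lam p alpha θ₂ φ ψ + buresDist θ₁.1.1 θ₂.1.1 := by
    have h₁ := bkEDist_ne_top (lam := lam) hp halpha.1.le θ₂ φ ψ
    have h₂ := buresEDist_cone_ne_top θ₁ θ₂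
    rw [bkDist, bkDist, buresDist, ← ENNReal.toReal_add h₁ h₂]
    exact ENNReal.toReal_mono (ENNReal.add_ne_top.mpr ⟨h₁, h₂⟩) (bkEDist_le_add hp θ₁ θ₂ φ ψ)
  have h₁ := key θ₁ θ₂
  have h₂ := key θ₂ θ₁
  rw [(isMetric_buresDist A H).symm θ₂ θ₁] at h₂
  exact abs_sub_le_iff.mpr ⟨by linarith, by linarith⟩

end BuresKuratowskiDistance

end BuresKuratowski

end

theorem mainTheorem4 {A : Type u} {H : Type v}
    [CStarAlgebra A] [PartialOrder A] [StarOrderedRing A]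
    [NormedAddCommGroup H] [InnerProductSpace ℂ H] [CompleteSpace H]
    (lam : ℝ) (hlam : 0 < lam) (p : ℝ≥0∞) (hp : 1 ≤ p)
    (alpha : ℝ) (halpha : alpha ∈ Set.Ioc (0 : ℝ) 1) :
    -- the Bures distance is finite on the cone and is a metric there
    (∀ θ₁ θ₂ : BuresKuratowski.CPCone A H,
      BuresKuratowski.buresEDist θ₁.1.1 θ₂.1.1 ≠ ⊤) ∧
    BuresKuratowski.IsMetric (fun θ₁ θ₂ : BuresKuratowski.CPCone A H =>
      BuresKuratowski.buresDist θ₁.1.1 θ₂.1.1) ∧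
    -- every Bures–Kuratowski distance is finite
    (∀ (θ : BuresKuratowski.CPCone A H) (φ ψ : BuresKuratowski.CB A H),
      BuresKuratowski.bkEDist lam p alpha θ φ ψ ≠ ⊤) ∧
    -- it is a metric, and the anchor map into the space of metrics is an isometric embedding
    ∃ hmet : ∀ θ : BuresKuratowski.CPCone A H,
        BuresKuratowski.IsMetric (BuresKuratowski.bkDist lam p alpha θ),
      Function.Injective (fun θ : BuresKuratowski.CPCone A H =>
        (⟨BuresKuratowski.bkDist lam p alpha θ, hmet θ⟩ :
          BuresKuratowski.Met (BuresKuratowski.CB A H))) ∧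
      ∀ θ₁ θ₂ : BuresKuratowski.CPCone A H,
        BuresKuratowski.uniformDist
            (⟨BuresKuratowski.bkDist lam p alpha θ₁, hmet θ₁⟩ :
              BuresKuratowski.Met (BuresKuratowski.CB A H))
            ⟨BuresKuratowski.bkDist lam p alpha θ₂, hmet θ₂⟩ =
          ENNReal.ofReal (BuresKuratowski.buresDist θ₁.1.1 θ₂.1.1) := by
  have hmet (θ : BuresKuratowski.CPCone A H) :=
    BuresKuratowski.isMetric_bkDist hlam hp halpha θ
  have hiso := BuresKuratowski.uniformDist_bkDist hp halpha hmet
  refine ⟨BuresKuratowski.buresEDist_cone_ne_top, BuresKuratowski.isMetric_buresDist A H,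
    BuresKuratowski.bkEDist_ne_top hp halpha.1.le, hmet, fun θ₁ θ₂ h => ?_, hiso⟩
  have h0 := hiso θ₁ θ₂
  dsimp only at h
  rw [← h] at h0
  have h1 : ENNReal.ofReal (BuresKuratowski.buresDist θ₁.1.1 θ₂.1.1) = 0 := by
    rw [← h0]
    simp [BuresKuratowski.uniformDist]
  rw [BuresKuratowski.ofReal_buresDist] at h1
  exact Subtype.ext (Subtype.ext (BuresKuratowski.eq_of_buresEDist_eq_zero h1))
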